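/- Let $\mathbb{C}_\times$ be the category of cartesian cubes, i.e. the opposite of the category of finite strictly bipointed sets $[n]=\{\bot,x_1,\dots,x_n,\top\}$ and bipointed functions, and let $\mathsf{cSet}=\mathsf{Set}^{\mathbb{C}_\times^{\mathrm{op}}}$ be the category of cartesian cubical sets. Write $\mathrm{I}^n=\mathrm{Hom}_{\mathbb{C}_\times}(-,[n])$ for the $n$-cube and $\mathrm{I}=\mathrm{I}^1$, with its two points $0,1:1\to\mathrm{I}$. For $n\ge 1$ and $e\in\{0,1\}$ let $i:\sqcup^n_e\rightarrowtail\mathrm{I}^n$ be the open box, i.e. the union of all the $(n-1)$-dimensional faces $x_j=d$ ($1\le j\le n$, $d\in\{0,1\}$) of $\mathrm{I}^n$ except the face $x_1=e$, and let $\pi:\mathrm{I}^n\to\mathrm{I}^{n-1}$ be the projection that forgets the first coordinate. A uniform Kan fibration is a map $f:Y\to X$ of cubical sets together with, for all $n\ge1$, $e\in\{0,1\}$, $k\ge 0$ and all $b:\mathrm{I}^k\times\sqcup^n_e\to Y$ and $a:\mathrm{I}^k\times\mathrm{I}^n\to X$ with $fb=a(1\times i)$, a chosen $\phi(a,b):\mathrm{I}^k\times\mathrm{I}^n\to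 Y$ with $\phi(a,b)(1\times i)=b$ and $f\phi(a,b)=a$, such that $\phi(a,b)(\alpha\times1)=\phi(a(\alpha\times1),b(\alpha\times1))$ for every $\alpha:\mathrm{I}^j\to\mathrm{I}^k$. It is normal if moreover $\phi\bigl(fc(1\times\pi),\,c(1\times\pi i)\bigr)=c(1\times\pi)$ for all $n$, $e$, $k$ and all $c:\mathrm{I}^k\times\mathrm{I}^{n-1}\to Y$. An algebraic weak factorization system on a category consists of a functorial factorization $f=\mathsf{R}(f)\circ\mathsf{L}(f)$ of its arrows, together with a multiplication making the endofunctor $\mathsf{R}$ of the arrow category, pointed by $\mathsf{L}$, into a monad, and a comultiplication making the endofunctor $\mathsf{L}$ of the arrow category, copointed by $\mathsf{R}$, into a comonad. An $\mathsf{R}$-map is an arrow admitting a structure of algebra for the monad $\mathsf{R}$; an $\mathsf{R}$-object is an object $A$ for which $A\to1$ is an $\mathsf{R}$-map; an $\mathsf{L}$-map is an arrow admitting a structure of coalgebra for the copointed endofunctor $\mathsf{L}$; an $(\mathsf{L},\mathsf{R})$-factorization of an arrow $h$ is a factorization $h=gf$ with $f$ an $\mathsf{L}$-map and $g$ an $\mathsf{R}$-map.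 Theorem. There is an algebraic weak factorization system $(\mathsf{L},\mathsf{R})$ on $\mathsf{cSet}$ such that (1) the $\mathsf{R}$-algebras are exactly the normal uniform Kan fibrations: for every map $f$ there is a bijection between the $\mathsf{R}$-algebra structures on $f$ and the normal uniform Kan fibration structures on $f$, and under these bijections a commutative square is a homomorphism of $\mathsf{R}$-algebras if and only if it preserves the chosen fillers; (2) for every $\mathsf{R}$-object $A$, the factorization $A\to A^{\mathrm{I}}\to A\times A$ of the diagonal of $A$, given by the constant-path map induced by $\mathrm{I}\to1$ and by the map induced by the two points $0,1:1\to\mathrm{I}$, is an $(\mathsf{L},\mathsf{R})$-factorization. -/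

import Mathlib

open CategoryTheory Opposite MonoidalCategory CartesianMonoidalCategory

/-! ## Algebraic weak factorization systems -/

section AWFS

universe v u

/-- A structure of algebra for the monad `T` on the object `X`. -/
structure MonadAlgebraOn {D : Type u} [Category.{v} D] (T : Monad D) (X : D) where
  /-- the structure map -/
  act : T.obj X ⟶ X
  unit : T.η.app X ≫ act = 𝟙 X
  assoc : T.μ.app X ≫ act = T.map act ≫ act

/-- `h : X ⟶ Y` is a homomorphism of algebras, for given algebra structures on `X` and `Y`. -/
def MonadAlgebraOn.IsHom {D : Type u} [Category.{v} D] {T : Monad D} {X Y : D}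
    (s : MonadAlgebraOn T X) (t : MonadAlgebraOn T Y) (h : X ⟶ Y) : Prop :=
  T.map h ≫ t.act = s.act ≫ h

/-- A functorial factorization `f = R(f) ∘ L(f)` of all the morphisms of `C`. Here `Z` is the
functor `E`, and `i.app f : X ⟶ E(f)`, `p.app f : E(f) ⟶ Y` are `L(f)` and `R(f)`. -/
abbrev FunctorialFactorization (C : Type u) [Category.{v} C] :=
  MorphismProperty.FunctorialFactorizationData (⊤ : MorphismProperty C) ⊤

namespace FunctorialFactorization

variable {C : Type u} [Category.{v} C] (F : FunctorialFactorization C)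

/-- The endofunctor `R` of the arrow category. -/
def R : Arrow C ⥤ Arrow C where
  obj f := Arrow.mk (F.p.app f)
  map h := Arrow.homMk (F.Z.map h) h.right (F.p.naturality h)
  map_id f := by
    ext
    · exact F.Z.map_id f
    · rfl
  map_comp g h := by
    ext
    · exact F.Z.map_comp g h
    · rfl

/-- The endofunctor `L` of the arrow category. -/
def L : Arrow C ⥤ Arrow C where
  obj f := Arrow.mk (F.i.app f)
  map h := Arrow.homMk h.left (F.Z.map h) (F.i.naturality h)
  map_id f := by
    ext
    · rfl
    · exact F.Z.map_id f
  map_comp g h := by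
    ext
    · rfl
    · exact F.Z.map_comp g h

/-- The point `f ⟶ R f` of the endofunctor `R`, with components `L(f)` and the identity. -/
def unitR : 𝟭 (Arrow C) ⟶ F.R where
  app f := Arrow.homMk (F.i.app f) (𝟙 f.right) ((F.fac_app).trans (Category.comp_id f.hom).symm)
  naturality f g h := by
    ext
    · exact F.i.naturality h
    · exact (Category.comp_id h.right).trans (Category.id_comp h.right).symm

/-- The copoint `L f ⟶ f` of the endofunctor `L`, with components the identity and `R(f)`. -/
def counitL : F.L ⟶ 𝟭 (Arrow C) where
  app f := Arrow.homMk (𝟙 f.left) (F.p.app f)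
    ((Category.id_comp f.hom).trans F.fac_app.symm)
  naturality f g h := by
    ext
    · exact (Category.comp_id h.left).trans (Category.id_comp h.left).symm
    · exact F.p.naturality h

end FunctorialFactorization

/-- An algebraic weak factorization system: a functorial factorization, a multiplication making
`R` a monad with unit `unitR`, and a comultiplication making `L` a comonad with counit `counitL`.
(The unit laws force the multiplication to be the identity on codomains, and
the counit laws force the comultiplication to be the identity on domains.) -/
structure AWFS (C : Type u) [Category.{v} C] where
  /-- the underlying functorial factorization -/
  fac : FunctorialFactorization C
  /-- the multiplication of `R` -/
  mul : fac.R ⋙ fac.R ⟶ fac.R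
  mul_assoc : ∀ f, fac.R.map (mul.app f) ≫ mul.app f = mul.app (fac.R.obj f) ≫ mul.app f
  unit_mul : ∀ f, fac.unitR.app (fac.R.obj f) ≫ mul.app f = 𝟙 (fac.R.obj f)
  mul_unit : ∀ f, fac.R.map (fac.unitR.app f) ≫ mul.app f = 𝟙 (fac.R.obj f)
  /-- the comultiplication of `L` -/
  comul : fac.L ⟶ fac.L ⋙ fac.L
  comul_assoc : ∀ f,
    comul.app f ≫ fac.L.map (comul.app f) = comul.app f ≫ comul.app (fac.L.obj f)
  counit_comul : ∀ f, comul.app f ≫ fac.counitL.app (fac.L.obj f) = 𝟙 (fac.L.obj f)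
  comul_counit : ∀ f, comul.app f ≫ fac.L.map (fac.counitL.app f) = 𝟙 (fac.L.obj f)

namespace AWFS

variable {C : Type u} [Category.{v} C] (W : AWFS C)

/-- The monad `R` on the arrow category. -/
def rightMonad : Monad (Arrow C) where
  toFunctor := W.fac.R
  η := W.fac.unitR
  μ := W.mul
  assoc := W.mul_assoc
  left_unit := W.unit_mul
  right_unit := W.mul_unit

/-- The comonad `L` on the arrow category. -/
def leftComonad : Comonad (Arrow C) where
  toFunctor := W.fac.L
  ε := W.fac.counitL
  δ := W.comul
  coassoc := W.comul_assoc
  left_counit := W.counit_comul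
  right_counit := W.comul_counit

/-- The `R`-algebra structures on a morphism. -/
abbrev RAlgebra {X Y : C} (f : X ⟶ Y) := MonadAlgebraOn W.rightMonad (Arrow.mk f)

/-- `f` is an `R`-map: it carries a structure of algebra for the monad `R`. -/
def IsRMap {X Y : C} (f : X ⟶ Y) : Prop := Nonempty (W.RAlgebra f)

/-- `f` is an `L`-map: it carries a structure of coalgebra for the copointed endofunctor `L`. -/
def IsLMap {X Y : C} (f : X ⟶ Y) : Prop :=
  ∃ s : Arrow.mk f ⟶ W.leftComonad.obj (Arrow.mk f),
    s ≫ W.leftComonad.ε.app (Arrow.mk f) = 𝟙 (Arrow.mk f)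

/-- `h = g ∘ f` is a factorization of `h` into an `L`-map followed by an `R`-map. -/
def IsLRFactorization {X E Y : C} (f : X ⟶ E) (g : E ⟶ Y) (h : X ⟶ Y) : Prop :=
  f ≫ g = h ∧ W.IsLMap f ∧ W.IsRMap g

end AWFS

end AWFS

/-! ## Cartesian cubical sets -/

/-- The finite strictly bipointed set `[n] = {⊥, x₁, …, xₙ, ⊤}`. -/
inductive BipointedFin (n : ℕ) : Type
  | bot : BipointedFin n
  | var (i : Fin n) : BipointedFin n
  | top : BipointedFin n

/-- The distinguished points: `⊥` for `false` (written `0`) and `⊤` for `true` (written `1`). -/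
def BipointedFin.point {n : ℕ} : Bool → BipointedFin n
  | false => .bot
  | true => .top

/-- The extension of a function on the variables to a function that preserves the points. -/
def BipointedFin.elim {m n : ℕ} (g : Fin n → BipointedFin m) : BipointedFin n → BipointedFin m
  | .bot => .bot
  | .var i => g i
  | .top => .top

/-- The objects `[n]` of the category of cartesian cubes. -/
structure Cube : Type where
  /-- the dimension -/
  dim : ℕ

/-- Morphisms `[m] ⟶ [n]` of cubes: the bipointed functions in the opposite direction,
from `{⊥, x₁, …, xₙ, ⊤}` to `{⊥, x₁, …, xₘ, ⊤}`. -/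
@[ext]
structure Cube.Hom (m n : Cube) : Type where
  /-- the underlying function -/
  toFun : BipointedFin n.dim → BipointedFin m.dim
  map_bot : toFun .bot = .bot
  map_top : toFun .top = .top

/-- The category of cartesian cubes, the opposite of the category of the finite strictly bipointed
sets `[n]`. -/
instance : SmallCategory Cube where
  Hom := Cube.Hom
  id _ := ⟨id, rfl, rfl⟩
  comp f g := ⟨f.toFun ∘ g.toFun, by simp [g.map_bot, f.map_bot], by simp [g.map_top, f.map_top]⟩

/-- The morphism `[m] ⟶ [n]` of cubes with given coordinates. -/
def Cube.ofCoords {m n : ℕ} (g : Fin n → BipointedFin m) : Cube.mk m ⟶ Cube.mk n :=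
  (⟨BipointedFin.elim g, rfl, rfl⟩ : Cube.Hom _ _)

/-- The face map `[n] ⟶ [n+1]` whose `i`-th coordinate is the endpoint `d`. -/
def Cube.face {n : ℕ} (i : Fin (n + 1)) (d : Bool) : Cube.mk n ⟶ Cube.mk (n + 1) :=
  Cube.ofCoords (i.insertNth (α := fun _ => BipointedFin n) (.point d) .var)

/-- The projection `[n+1] ⟶ [n]` that forgets the first coordinate. -/
def Cube.proj (n : ℕ) : Cube.mk (n + 1) ⟶ Cube.mk n :=
  Cube.ofCoords fun i => .var i.succ

/-- The category of cartesian cubical sets: presheaves of sets on the category of cubes. -/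
abbrev CubicalSet := Cubeᵒᵖ ⥤ Type

namespace CubicalSet

/-- The geometric `n`-cube `Iⁿ`. -/
abbrev cube (n : ℕ) : CubicalSet := yoneda.obj (Cube.mk n)

/-- The open `(n+1)`-box in `Iⁿ⁺¹` that is open in the first coordinate: the union of all the faces
but the face `(0, e)`. The upper box is the case `e = true`, the lower box the case `e = false`. -/
def openBox (n : ℕ) (e : Bool) : Subfunctor (cube (n + 1)) :=
  ⨆ (p : Fin (n + 1) × Bool) (_ : p ≠ (0, e)), Subfunctor.range (yoneda.map (Cube.face p.1 p.2))

/-- The cubical set underlying the open box. -/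
abbrev box (n : ℕ) (e : Bool) : CubicalSet := (openBox n e).toFunctor

/-- The inclusion `Iᵏ × ⊔ⁿ⁺¹ ⟶ Iᵏ × Iⁿ⁺¹` of the generalized open box. -/
abbrev boxIncl (k n : ℕ) (e : Bool) : cube k ⊗ box n e ⟶ cube k ⊗ cube (n + 1) :=
  cube k ◁ (openBox n e).ι

/-- The projection `Iᵏ × Iⁿ⁺¹ ⟶ Iᵏ × Iⁿ` in the direction in which the boxes are open. -/
abbrev openProj (k n : ℕ) : cube k ⊗ cube (n + 1) ⟶ cube k ⊗ cube n :=
  cube k ◁ yoneda.map (Cube.proj n)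

/-- A structure of uniform Kan fibration on `f : Y ⟶ X`: a choice of diagonal fillers for all the
squares from a generalized (upper or lower) open box to `f`, natural in the cube `Iᵏ`. -/
structure UniformKanFibration {Y X : CubicalSet} (f : Y ⟶ X) where
  /-- the chosen filler of the square with top `b` and bottom `a` -/
  fill (n : ℕ) (e : Bool) (k : ℕ) (b : cube k ⊗ box n e ⟶ Y) (a : cube k ⊗ cube (n + 1) ⟶ X)
    (w : b ≫ f = boxIncl k n e ≫ a) : cube k ⊗ cube (n + 1) ⟶ Y
  boxIncl_fill : ∀ n e k b a w, boxIncl k n e ≫ fill n e k b a w = b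
  fill_comp : ∀ n e k b a w, fill n e k b a w ≫ f = a
  natural : ∀ n e (j k : ℕ) (α : cube j ⟶ cube k) b a w,
    α ▷ cube (n + 1) ≫ fill n e k b a w =
      fill n e j (α ▷ box n e ≫ b) (α ▷ cube (n + 1) ≫ a)
        (by rw [Category.assoc, w, whisker_exchange_assoc])

/-- A structure of normal Kan fibration: a uniform Kan fibration for which the chosen filler of a
degenerate open box is degenerate, that is, `φ(f c π, c π i) = c π` for all
`c : Iᵏ × Iⁿ ⟶ Y`, with `π` the projection in the direction in which the box is open. -/
structure NormalKanFibration {Y X : CubicalSet} (f : Y ⟶ X) extends UniformKanFibration f where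
  normal : ∀ n e k (c : cube k ⊗ cube n ⟶ Y),
    fill n e k (boxIncl k n e ≫ openProj k n ≫ c) (openProj k n ≫ c ≫ f)
      (by simp only [Category.assoc]) = openProj k n ≫ c

/-- The square `(u, v)` from `f` to `f'` preserves the chosen fillers. -/
def NormalKanFibration.IsHom {Y X Y' X' : CubicalSet} {f : Y ⟶ X} {f' : Y' ⟶ X'}
    (s : NormalKanFibration f) (s' : NormalKanFibration f') (u : Y ⟶ Y') (v : X ⟶ X')
    (h : u ≫ f' = f ≫ v) : Prop :=
  ∀ n e k b a w, s.fill n e k b a w ≫ u =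
    s'.fill n e k (b ≫ u) (a ≫ v)
      (by rw [Category.assoc, h, ← Category.assoc, w, Category.assoc])

/-- The endpoint `0` or `1` of the 1-cube. -/
def endpoint (d : Bool) : 𝟙_ CubicalSet ⟶ cube 1 where
  app c := ↾fun _ => Cube.ofCoords (m := c.unop.dim) fun _ => .point d
  naturality c c' f := by
    ext x
    refine Cube.Hom.ext (funext fun y => ?_)
    cases y with
    | bot => exact f.unop.map_bot.symm
    | top => exact f.unop.map_top.symm
    | var i =>
      cases d
      · exact f.unop.map_bot.symm
      · exact f.unop.map_top.symm

/-- The path object `A^I`. -/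
noncomputable abbrev pathObject (A : CubicalSet) : CubicalSet := (ihom (cube 1)).obj A

/-- The map `A ⟶ A^I` of constant paths, induced by `I ⟶ 1`. -/
noncomputable def constPath (A : CubicalSet) : A ⟶ pathObject A :=
  MonoidalClosed.curry (snd (cube 1) A)

/-- The evaluation `A^I ⟶ A` at an endpoint of `I`. -/
noncomputable def evalAt (A : CubicalSet) (d : Bool) : pathObject A ⟶ A :=
  lift (toUnit (pathObject A) ≫ endpoint d) (𝟙 (pathObject A)) ≫ (ihom.ev (cube 1)).app A

/-- The map `A^I ⟶ A × A` induced by the two endpoints `0, 1` of `I`. -/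
noncomputable def endpoints (A : CubicalSet) : pathObject A ⟶ A ⊗ A :=
  lift (evalAt A false) (evalAt A true)

/-- The diagonal `A ⟶ A × A`. -/
def diagonal (A : CubicalSet) : A ⟶ A ⊗ A := lift (𝟙 A) (𝟙 A)

end CubicalSet

-- A normal uniform Kan fibration structure is an algebraic structure on a map: operations (the
-- fillers) subject to equations (boundary, base, uniformity, normality). Part (1) is therefore a
-- statement about free algebras. Suppose every f : A ⟶ X factors through a free filling E(f) over
-- the same base X. Then f ↦ (E(f) ⟶ X) is the free monad, whose algebras are the fillings
-- (`algebraEquiv`, `algebra_isHom_iff`). Since fillings compose, E(L f) ⟶ E(f) ⟶ X carries a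
-- filling too, and freeness gives a comparison E(f) ⟶ E(L f), which is the comultiplication. Every
-- law of an algebraic weak factorization system is an equality of two homomorphisms out of a free
-- filling that agree on generators.
--
-- Free fillings exist over any small category (`freeFilling`): take well-founded trees of formal
-- fillers over the elements of A and divide by the inductively generated partial equivalence
-- relation that imposes the equations. No transfinite iteration is needed.
--
-- Part (2) has two halves. The box of dimension n+1 is (box of dimension n) × I ∪ Iⁿ × ∂I, so an
-- open box of paths in A with prescribed endpoints is an open box in A of one dimension more. This
-- makes A^I ⟶ A × A a normal Kan fibration (`endpointsFibration`). For A ⟶ A^I, filling a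
-- 2-dimensional box contracts each path to its starting point, and normality keeps constant paths
-- constant (`exists_contraction`). Given a normal Kan fibration Y ⟶ A^I and a partial section on
-- constant paths, transport the value at the starting point of each path along the contraction. By
-- normality again, the transport does nothing over constant paths, so it extends the partial
-- section (`exists_lift_constPath`). Lifting against E(f) ⟶ X then yields the coalgebra structure.

universe w v u

/-! ### Natural and normal fillings, and their composition -/

/-- Generating lifting problems in a category: morphisms `ι j : U j ⟶ V j` with reindexings along
which fillers are to be natural, and morphisms `π j : V j ⟶ W j` along which degenerate problems are
to have degenerate fillers. -/
structure LiftingData (C : Type u) [Category.{v} C] where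
  /-- the index type of the lifting problems -/
  J : Type w
  /-- the domains -/
  U : J → C
  /-- the codomains -/
  V : J → C
  /-- the objects that detect degenerate problems -/
  W : J → C
  /-- the generating morphisms -/
  ι (j : J) : U j ⟶ V j
  /-- the projections -/
  π (j : J) : V j ⟶ W j
  /-- the reindexings -/
  H : J → J → Type w
  /-- the action of reindexings on domains -/
  uMap {j k : J} (α : H j k) : U j ⟶ U k
  /-- the action of reindexings on codomains -/
  vMap {j k : J} (α : H j k) : V j ⟶ V k
  comm {j k : J} (α : H j k) : uMap α ≫ ι k = ι j ≫ vMap α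

namespace LiftingData

variable {C : Type u} [Category.{v} C] (D : LiftingData.{w} C)

/-- A natural and normal choice of fillers against `f`. -/
structure Filling {Y X : C} (f : Y ⟶ X) where
  /-- the chosen filler -/
  fill (j : D.J) (b : D.U j ⟶ Y) (a : D.V j ⟶ X) (w : b ≫ f = D.ι j ≫ a) : D.V j ⟶ Y
  ι_fill : ∀ j b a w, D.ι j ≫ fill j b a w = b
  fill_comp : ∀ j b a w, fill j b a w ≫ f = a
  natural : ∀ {j k} (α : D.H j k) b a w, D.vMap α ≫ fill k b a w =
    fill j (D.uMap α ≫ b) (D.vMap α ≫ a)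
      (by rw [Category.assoc, w, ← Category.assoc, D.comm, Category.assoc])
  normal : ∀ j (c : D.W j ⟶ Y), fill j (D.ι j ≫ D.π j ≫ c) (D.π j ≫ c ≫ f)
    (by simp only [Category.assoc]) = D.π j ≫ c

namespace Filling

variable {D}

lemma fill_congr {Y X : C} {f : Y ⟶ X} (s : D.Filling f) {j : D.J} {b b' : D.U j ⟶ Y}
    {a a' : D.V j ⟶ X} (w : b ≫ f = D.ι j ≫ a) (hb : b = b') (ha : a = a') :
    s.fill j b a w = s.fill j b' a' (by rw [← hb, ← ha, w]) := by
  subst hb ha; rfl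

@[ext]
lemma ext {Y X : C} {f : Y ⟶ X} {s t : D.Filling f}
    (h : ∀ j b a w, s.fill j b a w = t.fill j b a w) : s = t := by
  cases s; cases t
  congr
  funext j b a w
  exact h j b a w

/-- `(u, v)` is a square that preserves the chosen fillers. -/
structure IsHom {Y X Y' X' : C} {f : Y ⟶ X} {f' : Y' ⟶ X'} (s : D.Filling f) (s' : D.Filling f')
    (u : Y ⟶ Y') (v : X ⟶ X') : Prop where
  sq : u ≫ f' = f ≫ v
  fill_comp : ∀ j b a w, s.fill j b a w ≫ u = s'.fill j (b ≫ u) (a ≫ v)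
    (by rw [Category.assoc, sq, ← Category.assoc, w, Category.assoc])

lemma IsHom.id {Y X : C} {f : Y ⟶ X} (s : D.Filling f) : s.IsHom s (𝟙 Y) (𝟙 X) where
  sq := by simp
  fill_comp j b a w := by
    rw [Category.comp_id]
    exact s.fill_congr _ (Category.comp_id _).symm (Category.comp_id _).symm

lemma IsHom.trans {Y X Y' X' Y'' X'' : C} {f : Y ⟶ X} {f' : Y' ⟶ X'} {f'' : Y'' ⟶ X''}
    {s : D.Filling f} {s' : D.Filling f'} {s'' : D.Filling f''} {u : Y ⟶ Y'} {v : X ⟶ X'}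
    {u' : Y' ⟶ Y''} {v' : X' ⟶ X''}
    (hs : s.IsHom s' u v) (hs' : s'.IsHom s'' u' v') : s.IsHom s'' (u ≫ u') (v ≫ v') where
  sq := by rw [Category.assoc, hs'.sq, ← Category.assoc, hs.sq, Category.assoc]
  fill_comp j b a w := by
    rw [← Category.assoc, hs.fill_comp, hs'.fill_comp]
    exact s''.fill_congr _ (Category.assoc _ _ _) (Category.assoc _ _ _)

/-- Fillings compose: fill against `g`, then lift the result against `f`. -/
@[simps]
def comp {Y X Z : C} {f : Y ⟶ X} {g : X ⟶ Z} (s : D.Filling f) (t : D.Filling g) :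
    D.Filling (f ≫ g) where
  fill j b a w := s.fill j b (t.fill j (b ≫ f) a (by rw [Category.assoc, w])) (t.ι_fill _ _ _ _).symm
  ι_fill j b a w := s.ι_fill _ _ _ _
  fill_comp j b a w := by rw [← Category.assoc, s.fill_comp, t.fill_comp]
  natural α b a w := by
    rw [s.natural]
    refine s.fill_congr _ rfl ?_
    rw [t.natural]
    exact t.fill_congr _ (Category.assoc _ _ _).symm rfl
  normal j c := by
    refine Eq.trans (s.fill_congr _ rfl ?_) (s.normal j c)
    rw [← t.normal j (c ≫ f)]
    exact t.fill_congr _ (by simp only [Category.assoc]) (by simp only [Category.assoc])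

lemma IsHom.comp {Y X Z Y' X' Z' : C} {f : Y ⟶ X} {g : X ⟶ Z} {f' : Y' ⟶ X'} {g' : X' ⟶ Z'}
    {s : D.Filling f} {t : D.Filling g} {s' : D.Filling f'} {t' : D.Filling g'}
    {u : Y ⟶ Y'} {v : X ⟶ X'} {z : Z ⟶ Z'}
    (hs : s.IsHom s' u v) (ht : t.IsHom t' v z) : (s.comp t).IsHom (s'.comp t') u z where
  sq := by rw [← Category.assoc, hs.sq, Category.assoc, ht.sq, Category.assoc]
  fill_comp j b a w := by
    rw [comp_fill, comp_fill, hs.fill_comp]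
    refine s'.fill_congr _ rfl ?_
    rw [ht.fill_comp]
    exact t'.fill_congr _ (by rw [Category.assoc, Category.assoc, hs.sq]) rfl

lemma isHom_comp_left {Y X Z : C} {f : Y ⟶ X} {g : X ⟶ Z} (s : D.Filling f) (t : D.Filling g) :
    (s.comp t).IsHom t f (𝟙 Z) where
  sq := (Category.comp_id _).symm
  fill_comp j b a w := by
    rw [comp_fill, s.fill_comp]
    exact t.fill_congr _ rfl (Category.comp_id _).symm

/-- A homomorphism over a filled morphism `g` is also a homomorphism from the composite with `g`. -/
lemma IsHom.of_comp {Y X Z Y' : C} {f : Y ⟶ X} {g : X ⟶ Z} {f' : Y' ⟶ Z} {s : D.Filling f}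
    {s' : D.Filling f'} (t : D.Filling g) {u : Y ⟶ Y'} (hs : s.IsHom s' u g) :
    (s.comp t).IsHom s' u (𝟙 Z) where
  sq := by rw [hs.sq, Category.comp_id]
  fill_comp j b a w := by
    rw [comp_fill, hs.fill_comp]
    exact s'.fill_congr _ rfl (by rw [t.fill_comp, Category.comp_id])

/-- Composition of fillings is associative. -/
lemma IsHom.assoc {Y' X' Y X Z T : C} {f' : Y' ⟶ X'} {s' : D.Filling f'} {f : Y ⟶ X} {g : X ⟶ Z}
    {k : Z ⟶ T} {s : D.Filling f} {t : D.Filling g} {r : D.Filling k} {u : Y' ⟶ Y} {v : X' ⟶ T}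
    (h : s'.IsHom ((s.comp t).comp r) u v) : s'.IsHom (s.comp (t.comp r)) u v where
  sq := by rw [h.sq.symm, Category.assoc]
  fill_comp j b a w := by
    rw [h.fill_comp]
    simp only [comp_fill]
    exact s.fill_congr _ rfl (t.fill_congr _ rfl (r.fill_congr _ (Category.assoc _ _ _).symm rfl))

end Filling

/-- A free filling on `f`, with the same codomain. -/
structure FreeFilling {A X : C} (f : A ⟶ X) where
  /-- the domain -/
  E : C
  /-- the inclusion of generators -/
  i : A ⟶ E
  /-- the underlying morphism -/
  p : E ⟶ X
  fac : i ≫ p = f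
  /-- the structure -/
  str : D.Filling p
  /-- the extension of a square to a homomorphism -/
  desc {Y Z : C} {g : Y ⟶ Z} (t : D.Filling g) (a : A ⟶ Y) (z : X ⟶ Z) (h : a ≫ g = f ≫ z) : E ⟶ Y
  i_desc {Y Z : C} {g : Y ⟶ Z} (t : D.Filling g) (a : A ⟶ Y) (z : X ⟶ Z) (h : a ≫ g = f ≫ z) :
    i ≫ desc t a z h = a
  isHom_desc {Y Z : C} {g : Y ⟶ Z} (t : D.Filling g) (a : A ⟶ Y) (z : X ⟶ Z)
    (h : a ≫ g = f ≫ z) : str.IsHom t (desc t a z h) z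
  hom_ext {Y Z : C} {g : Y ⟶ Z} {t : D.Filling g} {z z' : X ⟶ Z} {k l : E ⟶ Y}
    (hk : str.IsHom t k z) (hl : str.IsHom t l z') (hz : z = z') (h : i ≫ k = i ≫ l) : k = l

/-! ### The algebraic weak factorization system of free fillings -/

section AWFS

variable {D}

attribute [simp] FreeFilling.i_desc FreeFilling.fac

@[simp]
lemma FreeFilling.i_desc_assoc {A X : C} {f : A ⟶ X} (F : D.FreeFilling f) {Y Z : C} {g : Y ⟶ Z}
    (t : D.Filling g) (a : A ⟶ Y) (z : X ⟶ Z) (h : a ≫ g = f ≫ z) {T : C} (k : Y ⟶ T) :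
    F.i ≫ F.desc t a z h ≫ k = a ≫ k := by
  rw [← Category.assoc, F.i_desc]

variable (F : ∀ ⦃A X : C⦄ (f : A ⟶ X), D.FreeFilling f)

/-- The functorial factorization through free fillings. -/
def freeFactorization : FunctorialFactorization C where
  Z :=
    { obj f := (F f.hom).E
      map {f g} h := (F f.hom).desc (F g.hom).str (h.left ≫ (F g.hom).i) h.right
        (by rw [Category.assoc, (F g.hom).fac, h.w])
      map_id f := by
        refine (F f.hom).hom_ext ((F f.hom).isHom_desc _ _ _ _) (Filling.IsHom.id _) rfl ?_
        rw [(F f.hom).i_desc]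
        simp
      map_comp {f g k} h h' := by
        refine (F f.hom).hom_ext ((F f.hom).isHom_desc _ _ _ _)
          (((F f.hom).isHom_desc _ _ _ _).trans ((F g.hom).isHom_desc _ _ _ _)) rfl ?_
        rw [(F f.hom).i_desc, ← Category.assoc, (F f.hom).i_desc, Category.assoc,
          (F g.hom).i_desc]
        simp }
  i :=
    { app f := (F f.hom).i
      naturality f g h := ((F f.hom).i_desc _ _ _ _).symm }
  p :=
    { app f := (F f.hom).p
      naturality f g h := ((F f.hom).isHom_desc _ _ _ _).sq }
  fac := by
    ext f
    exact (F f.hom).fac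
  hi _ := trivial
  hp _ := trivial

/-- The functorial action on free fillings. -/
abbrev freeMap {A X B Y : C} {f : A ⟶ X} {g : B ⟶ Y} (u : A ⟶ B) (v : X ⟶ Y)
    (h : u ≫ g = f ≫ v) : (F f).E ⟶ (F g).E :=
  (F f).desc (F g).str (u ≫ (F g).i) v (by rw [Category.assoc, (F g).fac, h])

/-- The multiplication at `f`: evaluation of free fillings on a free filling. -/
abbrev freeEval {A X : C} (f : A ⟶ X) : (F (F f).p).E ⟶ (F f).E :=
  (F (F f).p).desc (F f).str (𝟙 _) (𝟙 _) (by simp)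

/-- The comultiplication at `f`: comparison with the composite of two free fillings. -/
abbrev freeSplit {A X : C} (f : A ⟶ X) : (F f).E ⟶ (F (F f).i).E :=
  (F f).desc ((F (F f).i).str.comp (F f).str) (F (F f).i).i (𝟙 _)
    (by rw [← Category.assoc, (F (F f).i).fac, (F f).fac, Category.comp_id])

/-- As for all the monad and comonad laws below, both sides are homomorphisms out of a free filling
over the same map of bases, so `hom_ext` leaves only a computation on generators. -/
lemma freeMap_freeEval {A X B Y : C} {f : A ⟶ X} {g : B ⟶ Y} (u : A ⟶ B) (v : X ⟶ Y)
    (h : u ≫ g = f ≫ v) :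
    freeMap F (freeMap F u v h) v ((F f).isHom_desc _ _ _ _).sq ≫ freeEval F g =
      freeEval F f ≫ freeMap F u v h := by
  refine (F (F f).p).hom_ext
    (((F _).isHom_desc _ _ _ _).trans ((F _).isHom_desc _ _ _ _))
    (((F _).isHom_desc _ _ _ _).trans ((F _).isHom_desc _ _ _ _)) (by simp) ?_
  simp

lemma freeEval_assoc {A X : C} (f : A ⟶ X) :
    freeMap F (freeEval F f) (𝟙 X) ((F _).isHom_desc _ _ _ _).sq ≫ freeEval F f =
      freeEval F (F f).p ≫ freeEval F f := by
  refine (F (F (F f).p).p).hom_ext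
    (((F _).isHom_desc _ _ _ _).trans ((F _).isHom_desc _ _ _ _))
    (((F _).isHom_desc _ _ _ _).trans ((F _).isHom_desc _ _ _ _)) rfl ?_
  simp

lemma freeMap_i_freeEval {A X : C} (f : A ⟶ X) :
    freeMap F (F f).i (𝟙 X) ((F f).fac.trans (Category.comp_id f).symm) ≫ freeEval F f = 𝟙 _ := by
  refine (F f).hom_ext (((F _).isHom_desc _ _ _ _).trans ((F _).isHom_desc _ _ _ _))
    (Filling.IsHom.id _) (Category.comp_id _) ?_
  simp

lemma freeMap_freeSplit {A X B Y : C} {f : A ⟶ X} {g : B ⟶ Y} (u : A ⟶ B) (v : X ⟶ Y)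
    (h : u ≫ g = f ≫ v) :
    freeMap F u v h ≫ freeSplit F g =
      freeSplit F f ≫ freeMap F u (freeMap F u v h) ((F f).i_desc _ _ _ _).symm := by
  refine (F f).hom_ext (((F _).isHom_desc _ _ _ _).trans ((F _).isHom_desc _ _ _ _))
    (((F _).isHom_desc _ _ _ _).trans
      (((F _).isHom_desc _ _ _ _).comp ((F _).isHom_desc _ _ _ _))) (by simp) ?_
  simp

lemma freeSplit_p {A X : C} (f : A ⟶ X) : freeSplit F f ≫ (F (F f).i).p = 𝟙 _ := by
  refine (F f).hom_ext (((F _).isHom_desc _ _ _ _).trans (Filling.isHom_comp_left _ _))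
    (Filling.IsHom.id _) (Category.comp_id _) ?_
  simp

lemma freeSplit_freeMap_p {A X : C} (f : A ⟶ X) :
    freeSplit F f ≫ freeMap F (𝟙 A) (F f).p ((Category.id_comp f).trans (F f).fac.symm) = 𝟙 _ := by
  refine (F f).hom_ext
    -- The second map lies over `(F f).p`, not over an identity. Since the fillers in `(F f).str`
    -- project to the given bottom map, `of_comp` makes it a homomorphism from the composite filling
    -- over the identity of the base.
    (((F _).isHom_desc _ _ _ _).trans (((F _).isHom_desc _ _ _ _).of_comp _))
    (Filling.IsHom.id _) (Category.comp_id _) ?_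
  simp

lemma freeSplit_coassoc {A X : C} (f : A ⟶ X) :
    freeSplit F f ≫ freeMap F (𝟙 A) (freeSplit F f)
        ((Category.id_comp _).trans ((F f).i_desc _ _ _ _).symm) =
      freeSplit F f ≫ freeSplit F (F f).i := by
  -- The two sides land in a threefold composite of fillings with different bracketings, which
  -- `assoc` reconciles.
  refine (F f).hom_ext
    (((F f).isHom_desc _ _ _ _).trans
      (((F (F f).i).isHom_desc _ _ _ _).comp ((F f).isHom_desc _ _ _ _)))
    (((F f).isHom_desc _ _ _ _).trans (((F (F f).i).isHom_desc _ _ _ _).comp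
      (Filling.IsHom.id (F f).str))).assoc (by simp) ?_
  simp

/-- The algebraic weak factorization system of free fillings. -/
def freeAWFS : AWFS C where
  fac := freeFactorization F
  mul :=
    { app f := Arrow.homMk (freeEval F f.hom) (𝟙 _) ((F _).isHom_desc _ _ _ _).sq
      naturality f g h := by
        ext
        · exact freeMap_freeEval F h.left h.right h.w
        · exact (Category.comp_id h.right).trans (Category.id_comp h.right).symm }
  mul_assoc f := by
    ext
    · exact freeEval_assoc F f.hom
    · rfl
  unit_mul f := by
    ext
    · exact (F _).i_desc _ _ _ _
    · exact Category.comp_id _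
  mul_unit f := by
    ext
    · exact freeMap_i_freeEval F f.hom
    · exact Category.comp_id _
  comul :=
    { app f := Arrow.homMk (𝟙 _) (freeSplit F f.hom)
        ((Category.id_comp _).trans ((F _).i_desc _ _ _ _).symm)
      naturality f g h := by
        ext
        · exact (Category.comp_id h.left).trans (Category.id_comp h.left).symm
        · exact freeMap_freeSplit F h.left h.right h.w }
  comul_assoc f := by
    ext
    · rfl
    · exact freeSplit_coassoc F f.hom
  counit_comul f := by
    ext
    · exact Category.comp_id _
    · exact freeSplit_p F f.hom
  comul_counit f := by
    ext
    · exact Category.comp_id _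
    · exact freeSplit_freeMap_p F f.hom


/-! ### Algebras of the free monad are fillings -/

/-- The evaluation of the free filling in a given filling. -/
abbrev fillingEval {Y X : C} {f : Y ⟶ X} (s : D.Filling f) : (F f).E ⟶ Y :=
  (F f).desc s (𝟙 _) (𝟙 _) (by simp)

lemma freeEval_fillingEval {Y X : C} {f : Y ⟶ X} (s : D.Filling f) :
    freeEval F f ≫ fillingEval F s =
      freeMap F (fillingEval F s) (𝟙 X) ((F f).isHom_desc _ _ _ _).sq ≫ fillingEval F s := by
  refine (F (F f).p).hom_ext
    (((F _).isHom_desc _ _ _ _).trans ((F _).isHom_desc _ _ _ _))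
    (((F _).isHom_desc _ _ _ _).trans ((F _).isHom_desc _ _ _ _)) rfl ?_
  simp

/-- The algebra structure given by a filling. -/
def algebraOfFilling {Y X : C} {f : Y ⟶ X} (s : D.Filling f) : (freeAWFS F).RAlgebra f where
  act := Arrow.homMk (fillingEval F s) (𝟙 _) ((F f).isHom_desc _ _ _ _).sq
  unit := by
    ext
    · exact (F f).i_desc _ _ _ _
    · exact Category.comp_id _
  assoc := by
    ext
    · exact freeEval_fillingEval F s
    · rfl

variable {F}

/-- The structure map of an algebra, on domains. -/
def structureMap {Y X : C} {f : Y ⟶ X} (s : (freeAWFS F).RAlgebra f) : (F f).E ⟶ Y := s.act.left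

/-- The unit of the monad is the identity on codomains, so the unit law forces this. -/
lemma act_right {Y X : C} {f : Y ⟶ X} (s : (freeAWFS F).RAlgebra f) : s.act.right = 𝟙 X :=
  (Category.id_comp _).symm.trans (congrArg Arrow.Hom.right s.unit)

lemma i_structureMap {Y X : C} {f : Y ⟶ X} (s : (freeAWFS F).RAlgebra f) :
    (F f).i ≫ structureMap s = 𝟙 Y :=
  congrArg Arrow.Hom.left s.unit

lemma structureMap_comp {Y X : C} {f : Y ⟶ X} (s : (freeAWFS F).RAlgebra f) :
    structureMap s ≫ f = (F f).p := by
  have h : structureMap s ≫ f = (F f).p ≫ s.act.right := s.act.w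
  rw [h, act_right]
  exact Category.comp_id _

lemma freeEval_structureMap {Y X : C} {f : Y ⟶ X} (s : (freeAWFS F).RAlgebra f) :
    freeEval F f ≫ structureMap s = freeMap F (structureMap s) (𝟙 X)
      ((structureMap_comp s).trans (Category.comp_id _).symm) ≫ structureMap s := by
  -- The codomain component of `s.act` is the identity only propositionally, and `freeMap` depends
  -- on it together with a proof. Hence the generalization to an arbitrary `v`.
  have aux : ∀ (v : X ⟶ X) (hv : structureMap s ≫ f = (F f).p ≫ v), v = 𝟙 X →
      freeMap F (structureMap s) v hv = freeMap F (structureMap s) (𝟙 X)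
        ((structureMap_comp s).trans (Category.comp_id _).symm) := by
    rintro _ _ rfl
    rfl
  rw [← aux s.act.right s.act.w (act_right s)]
  exact congrArg Arrow.Hom.left s.assoc

/-- The filling given by an algebra structure: fill in the free filling, then apply the
structure map. -/
def fillingOfAlgebra {Y X : C} {f : Y ⟶ X} (s : (freeAWFS F).RAlgebra f) : D.Filling f where
  fill j b a w := (F f).str.fill j (b ≫ (F f).i) a (by rw [Category.assoc, (F f).fac, w]) ≫
    structureMap s
  ι_fill j b a w := by
    rw [← Category.assoc (D.ι j), (F f).str.ι_fill, Category.assoc, i_structureMap,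
      Category.comp_id]
  fill_comp j b a w := by
    rw [Category.assoc (Filling.fill _ _ _ _ _), structureMap_comp, (F f).str.fill_comp]
  natural α b a w := by
    rw [← Category.assoc (D.vMap α), (F f).str.natural]
    congr 1
    exact (F f).str.fill_congr _ (Category.assoc _ _ _).symm rfl
  normal j c := by
    have h : D.π j ≫ c = (D.π j ≫ c ≫ (F f).i) ≫ structureMap s := by
      rw [Category.assoc, Category.assoc, i_structureMap, Category.comp_id]
    refine Eq.trans ?_ h.symm
    rw [← (F f).str.normal j (c ≫ (F f).i)]
    congr 1
    exact (F f).str.fill_congr _ (by simp only [Category.assoc])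
      (by rw [Category.assoc, (F f).fac])

/-- A filler in E(f) is the evaluation of a filler in the free filling on E(f) whose boundary
consists of generators. Associativity of the algebra replaces evaluation by the functorial action of
the structure map, which is itself a homomorphism. -/
lemma isHom_structureMap {Y X : C} {f : Y ⟶ X} (s : (freeAWFS F).RAlgebra f) :
    (F f).str.IsHom (fillingOfAlgebra s) (structureMap s) (𝟙 X) where
  sq := (structureMap_comp s).trans (Category.comp_id _).symm
  fill_comp j b a w := by
    have w' : (b ≫ (F (F f).p).i) ≫ (F (F f).p).p = D.ι j ≫ a := by
      rw [Category.assoc, (F _).fac, w]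
    have h := ((F (F f).p).isHom_desc (F f).str (𝟙 _) (𝟙 _) (by simp)).fill_comp j
      (b ≫ (F (F f).p).i) a w'
    have h' := ((F (F f).p).isHom_desc (F f).str (structureMap s ≫ (F f).i) (𝟙 _)
      (by rw [Category.assoc, (F f).fac, structureMap_comp, Category.comp_id])).fill_comp j
      (b ≫ (F (F f).p).i) a w'
    have e : (F f).str.fill j b a w =
        (F (F f).p).str.fill j (b ≫ (F (F f).p).i) a w' ≫ freeEval F f := by
      rw [h]
      exact (F f).str.fill_congr _
        (by rw [Category.assoc, (F (F f).p).i_desc, Category.comp_id]) (Category.comp_id _).symm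
    rw [e, Category.assoc (Filling.fill _ _ _ _ _), freeEval_structureMap,
      ← Category.assoc (Filling.fill _ _ _ _ _), h']
    change _ = _ ≫ structureMap s
    congr 1
    exact (F f).str.fill_congr _
      (by rw [Category.assoc, (F (F f).p).i_desc, Category.assoc]) rfl

variable (F)

/-- The algebras of the free filling monad are the fillings. -/
def algebraEquiv {Y X : C} (f : Y ⟶ X) : (freeAWFS F).RAlgebra f ≃ D.Filling f where
  toFun := fillingOfAlgebra
  invFun := algebraOfFilling F
  left_inv s := by
    -- Both structure maps are homomorphisms into the induced filling and restrict to the identity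
    -- on generators.
    have h : (algebraOfFilling F (fillingOfAlgebra s)).act = s.act := by
      refine Arrow.hom_ext _ _ ?_ (act_right s).symm
      refine (F f).hom_ext ((F f).isHom_desc _ _ _ _) (isHom_structureMap s) rfl ?_
      exact ((F f).i_desc _ _ _ _).trans (i_structureMap s).symm
    cases s
    simpa [algebraOfFilling] using h
  right_inv s := by
    ext j b a w
    refine (((F f).isHom_desc s (𝟙 _) (𝟙 _) (by simp)).fill_comp _ _ _ _).trans ?_
    exact s.fill_congr _ (by rw [Category.assoc, (F f).i_desc, Category.comp_id])
      (Category.comp_id _)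

lemma algebra_isHom_iff_structureMap {Y X Y' X' : C} {f : Y ⟶ X} {f' : Y' ⟶ X'}
    (s : (freeAWFS F).RAlgebra f) (s' : (freeAWFS F).RAlgebra f') (u : Y ⟶ Y') (v : X ⟶ X')
    (h : u ≫ f' = f ≫ v) :
    s.IsHom s' (Arrow.homMk u v h) ↔ freeMap F u v h ≫ structureMap s' = structureMap s ≫ u := by
  constructor
  · intro H
    exact congrArg Arrow.Hom.left H
  · intro H
    refine Arrow.hom_ext _ _ H ?_
    change v ≫ s'.act.right = s.act.right ≫ v
    rw [act_right, act_right]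
    exact (Category.comp_id _).trans (Category.id_comp _).symm

lemma algebra_isHom_iff {Y X Y' X' : C} {f : Y ⟶ X} {f' : Y' ⟶ X'}
    (s : (freeAWFS F).RAlgebra f) (s' : (freeAWFS F).RAlgebra f') (u : Y ⟶ Y') (v : X ⟶ X')
    (h : u ≫ f' = f ≫ v) :
    s.IsHom s' (Arrow.homMk u v h) ↔ (algebraEquiv F f s).IsHom (algebraEquiv F f' s') u v := by
  rw [algebra_isHom_iff_structureMap]
  constructor
  · intro H
    refine ⟨h, fun j b a w => ?_⟩
    change (_ ≫ structureMap s) ≫ u = _ ≫ structureMap s'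
    rw [Category.assoc (Filling.fill _ _ _ _ _), ← H, ← Category.assoc (Filling.fill _ _ _ _ _),
      ((F f).isHom_desc _ _ _ _).fill_comp]
    congr 1
    exact (F f').str.fill_congr _
      (by rw [Category.assoc, (F f).i_desc, Category.assoc]) rfl
  · intro H
    refine (F f).hom_ext (((F f).isHom_desc _ _ _ _).trans (isHom_structureMap s'))
      ((isHom_structureMap s).trans H) (by simp) ?_
    rw [(F f).i_desc_assoc, Category.assoc, i_structureMap, ← Category.assoc, i_structureMap,
      Category.id_comp, Category.comp_id]

/-- A morphism with the left lifting property against all filled morphisms is an `L`-map. -/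
lemma isLMap_of_lifts {A B : C} (f : A ⟶ B)
    (H : ∀ {Y : C} (p : Y ⟶ B) (_ : D.Filling p) (y : A ⟶ Y), y ≫ p = f →
      ∃ d : B ⟶ Y, f ≫ d = y ∧ d ≫ p = 𝟙 B) :
    (freeAWFS F).IsLMap f := by
  -- One instance suffices: a lift against the right factor of `f` itself, with the left factor on
  -- top, is exactly a coalgebra structure.
  obtain ⟨d, h, h'⟩ := H (F f).p (F f).str (F f).i (F f).fac
  refine ⟨Arrow.homMk (𝟙 A) d ((Category.id_comp _).trans h.symm), ?_⟩
  ext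
  · exact Category.comp_id _
  · exact h'

end AWFS

end LiftingData

/-! ### Terms and the laws of fillings -/

namespace LiftingData

variable {C : Type} [SmallCategory C] {D : LiftingData.{0} (Cᵒᵖ ⥤ Type)} {A X : Cᵒᵖ ⥤ Type}

variable (D) in
/-- Formal terms generated by the elements of `A` under formal fillers over `X`. -/
inductive Term (f : A ⟶ X) : Cᵒᵖ → Type
  | gen {c : Cᵒᵖ} (x : A.obj c) : Term f c
  -- The boundary is a bare family: its naturality holds only modulo the relation defined below, so
  -- it cannot be demanded here.
  | fill {c : Cᵒᵖ} (j : D.J) (b : ∀ d, (D.U j).obj d → Term f d) (a : D.V j ⟶ X)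
      (z : (D.V j).obj c) : Term f c

namespace Term

variable {f : A ⟶ X}

/-- The action of the base category on terms. -/
def map {c d : Cᵒᵖ} (φ : c ⟶ d) : D.Term f c → D.Term f d
  | gen x => gen (A.map φ x)
  | fill j b a z => fill j b a ((D.V j).map φ z)

/-- The element of `X` that a term lies over. -/
def base {c : Cᵒᵖ} : D.Term f c → X.obj c
  | gen x => f.app c x
  | fill _ _ a z => a.app c z

lemma map_id {c : Cᵒᵖ} (t : D.Term f c) : t.map (𝟙 c) = t := by
  cases t <;> simp [map]

lemma map_comp {c d e : Cᵒᵖ} (φ : c ⟶ d) (ψ : d ⟶ e) (t : D.Term f c) :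
    t.map (φ ≫ ψ) = (t.map φ).map ψ := by
  cases t <;> simp [map]

lemma base_map {c d : Cᵒᵖ} (φ : c ⟶ d) (t : D.Term f c) : (t.map φ).base = X.map φ t.base := by
  cases t <;> simp [map, base]

/-- The partial equivalence relation that imposes the laws of fillings. A term is meaningful
if it is related to itself. -/
inductive Rel : ∀ {c : Cᵒᵖ}, D.Term f c → D.Term f c → Prop
  | gen {c : Cᵒᵖ} (x : A.obj c) : Rel (gen x) (gen x)
  | symm {c : Cᵒᵖ} {t t' : D.Term f c} : Rel t t' → Rel t' t
  | trans {c : Cᵒᵖ} {t t' t'' : D.Term f c} : Rel t t' → Rel t' t'' → Rel t t''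
  -- Well-formedness of a formal filler refers to the relation itself. Generating a partial
  -- equivalence relation defines both at once, with well-formed meaning self-related.
  | fill {c : Cᵒᵖ} (j : D.J) (b b' : ∀ d, (D.U j).obj d → D.Term f d) (a : D.V j ⟶ X)
      (z : (D.V j).obj c) (h : ∀ d y, Rel (b d y) (b' d y))
      (nat : ∀ d d' (φ : d ⟶ d') y, Rel ((b d y).map φ) (b d' ((D.U j).map φ y)))
      (w : ∀ d y, (b d y).base = a.app d ((D.ι j).app d y)) :
      Rel (fill j b a z) (fill j b' a z)
  | boundary {c : Cᵒᵖ} (j : D.J) (b : ∀ d, (D.U j).obj d → D.Term f d) (a : D.V j ⟶ X)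
      (y : (D.U j).obj c)
      (nat : ∀ d d' (φ : d ⟶ d') y, Rel ((b d y).map φ) (b d' ((D.U j).map φ y)))
      (w : ∀ d y, (b d y).base = a.app d ((D.ι j).app d y)) :
      Rel (fill j b a ((D.ι j).app c y)) (b c y)
  | natural {c : Cᵒᵖ} {j k : D.J} (α : D.H j k) (b : ∀ d, (D.U k).obj d → D.Term f d)
      (a : D.V k ⟶ X) (z : (D.V j).obj c)
      (nat : ∀ d d' (φ : d ⟶ d') y, Rel ((b d y).map φ) (b d' ((D.U k).map φ y)))
      (w : ∀ d y, (b d y).base = a.app d ((D.ι k).app d y)) :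
      Rel (fill k b a ((D.vMap α).app c z))
        (fill j (fun d y => b d ((D.uMap α).app d y)) (D.vMap α ≫ a) z)
  | normal {c : Cᵒᵖ} (j : D.J) (t : ∀ d, (D.W j).obj d → D.Term f d) (a : D.V j ⟶ X)
      (z : (D.V j).obj c)
      (nat : ∀ d d' (φ : d ⟶ d') y, Rel ((t d y).map φ) (t d' ((D.W j).map φ y)))
      (w : ∀ d z, (t d ((D.π j).app d z)).base = a.app d z) :
      Rel (fill j (fun d y => t d ((D.π j).app d ((D.ι j).app d y))) a z)
        (t c ((D.π j).app c z))

lemma Rel.base_eq {c : Cᵒᵖ} {t t' : D.Term f c} (h : Rel t t') : t.base = t'.base := by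
  induction h with
  | gen x => rfl
  | symm _ ih => exact ih.symm
  | trans _ _ ih ih' => exact ih.trans ih'
  | fill => rfl
  | boundary j b a y nat w => exact (w _ _).symm
  | natural => rfl
  | normal j t a z nat w => exact (w _ _).symm

lemma Rel.map {c d : Cᵒᵖ} (φ : c ⟶ d) {t t' : D.Term f c} (h : Rel t t') :
    Rel (t.map φ) (t'.map φ) := by
  induction h with
  | gen x => exact .gen _
  | symm _ ih => exact (ih φ).symm
  | trans _ _ ih ih' => exact (ih φ).trans (ih' φ)
  | fill j b b' a z h nat w => exact .fill j b b' a _ h nat w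
  | boundary j b a y nat w =>
    refine .trans ?_ (nat _ _ φ y).symm
    have := Rel.boundary j b a ((D.U j).map φ y) nat w
    rwa [NatTrans.naturality_apply] at this
  | natural α b a z nat w =>
    have := Rel.natural α b a ((D.V _).map φ z) nat w
    rwa [NatTrans.naturality_apply] at this
  | normal j t a z nat w =>
    refine .trans ?_ (nat _ _ φ _).symm
    have := Rel.normal j t a ((D.V _).map φ z) nat w
    rwa [NatTrans.naturality_apply] at this

/-- A family of terms that represents the top of a lifting problem with bottom `a`. -/
structure Compat (j : D.J) (b : ∀ d, (D.U j).obj d → D.Term f d) (a : D.V j ⟶ X) : Prop where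
  nat : ∀ d d' (φ : d ⟶ d') y, Rel ((b d y).map φ) (b d' ((D.U j).map φ y))
  base : ∀ d y, (b d y).base = a.app d ((D.ι j).app d y)

lemma Compat.refl {j : D.J} {b : ∀ d, (D.U j).obj d → D.Term f d} {a : D.V j ⟶ X}
    (h : Compat j b a) (d : Cᵒᵖ) (y : (D.U j).obj d) : Rel (b d y) (b d y) := by
  have := h.nat d d (𝟙 d) y
  rwa [map_id, Functor.map_id_apply] at this

lemma Compat.fill {j : D.J} {b : ∀ d, (D.U j).obj d → D.Term f d} {a : D.V j ⟶ X}
    (h : Compat j b a) {c : Cᵒᵖ} (z : (D.V j).obj c) :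
    Rel (.fill j b a z) (.fill j b a z) :=
  .fill j b b a z h.refl h.nat h.base

/-- Induction over meaningful terms. -/
lemma Rel.induction {P : ∀ {c : Cᵒᵖ}, D.Term f c → Prop} (hgen : ∀ {c} (x : A.obj c), P (.gen x))
    (hfill : ∀ {c} j b a (z : (D.V j).obj c), Compat j b a → (∀ d y, P (b d y)) → P (.fill j b a z))
    {c : Cᵒᵖ} {t t' : D.Term f c} (h : Rel t t') : P t ∧ P t' := by
  induction h with
  | gen x => exact ⟨hgen x, hgen x⟩
  | symm _ ih => exact ih.symm
  | trans _ _ ih ih' => exact ⟨ih.1, ih'.2⟩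
  | fill j b b' a z h nat w ih =>
    -- The family `b'` inherits compatibility from `b`, to which it is related pointwise.
    exact ⟨hfill _ _ _ _ ⟨nat, w⟩ fun d y => (ih d y).1,
      hfill _ _ _ _ ⟨fun d d' φ y => (((h d y).map φ).symm.trans (nat d d' φ y)).trans (h _ _),
        fun d y => (h d y).base_eq.symm.trans (w d y)⟩ fun d y => (ih d y).2⟩
  | boundary j b a y nat w ih =>
    -- The induction hypothesis speaks of restricted terms; restriction along the identity recovers
    -- the family.
    have ih' : ∀ d y, P (b d y) := fun d y => by
      have := (ih d d (𝟙 d) y).1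
      rwa [map_id] at this
    exact ⟨hfill _ _ _ _ ⟨nat, w⟩ ih', ih' _ _⟩
  | natural α b a z nat w ih =>
    have ih' : ∀ d y, P (b d y) := fun d y => by
      have := (ih d d (𝟙 d) y).1
      rwa [map_id] at this
    refine ⟨hfill _ _ _ _ ⟨nat, w⟩ ih', hfill _ _ _ _ ⟨fun d d' φ y => ?_, fun d y => ?_⟩
      fun d y => ih' _ _⟩
    · rw [NatTrans.naturality_apply]
      exact nat d d' φ _
    · rw [w]
      exact congrArg (fun m => (m ≫ a).app d y) (D.comm α)
  | normal j t a z nat w ih =>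
    have ih' : ∀ d y, P (t d y) := fun d y => by
      have := (ih d d (𝟙 d) y).1
      rwa [map_id] at this
    refine ⟨hfill _ _ _ _ ⟨fun d d' φ y => ?_, fun d y => w _ _⟩ fun d y => ih' _ _, ih' _ _⟩
    rw [NatTrans.naturality_apply, NatTrans.naturality_apply]
    exact nat d d' φ _

variable (f) in
/-- The setoid of meaningful terms. -/
def setoid (c : Cᵒᵖ) : Setoid {t : D.Term f c // Rel t t} where
  r t t' := Rel t.1 t'.1
  iseqv := ⟨fun t => t.2, .symm, .trans⟩

end Term

/-! ### The presheaf of terms and its filling -/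

variable (D) in
/-- The presheaf of meaningful terms modulo the laws of fillings. -/
def freeObj (f : A ⟶ X) : Cᵒᵖ ⥤ Type where
  obj c := Quotient (Term.setoid (D := D) f c)
  map {c d} φ := ↾(Quotient.map (fun t => ⟨t.1.map φ, t.2.map φ⟩) fun _ _ h => Term.Rel.map φ h)
  map_id c := by
    ext x
    induction x using Quotient.inductionOn
    exact congrArg (Quotient.mk _) (Subtype.ext (Term.map_id _))
  map_comp φ ψ := by
    ext x
    induction x using Quotient.inductionOn
    exact congrArg (Quotient.mk _) (Subtype.ext (Term.map_comp _ _ _))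

namespace freeObj

variable {f : A ⟶ X}

/-- The element represented by a meaningful term. -/
def mk {c : Cᵒᵖ} (t : D.Term f c) (h : t.Rel t) : (freeObj D f).obj c :=
  Quotient.mk (Term.setoid f c) ⟨t, h⟩

lemma mk_eq {c : Cᵒᵖ} {t t' : D.Term f c} (h : t.Rel t') :
    mk t (h.trans h.symm) = mk t' (h.symm.trans h) :=
  Quotient.sound (s := Term.setoid f c) h

lemma map_mk {c d : Cᵒᵖ} (φ : c ⟶ d) (t : D.Term f c) (h : t.Rel t) :
    (freeObj D f).map φ (mk t h) = mk (t.map φ) (h.map φ) := rfl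

/-- A representative of an element. -/
noncomputable def rep {c : Cᵒᵖ} (x : (freeObj D f).obj c) : D.Term f c :=
  (Quotient.out (s := Term.setoid f c) x).1

lemma rep_refl {c : Cᵒᵖ} (x : (freeObj D f).obj c) : (rep x).Rel (rep x) :=
  (Quotient.out (s := Term.setoid f c) x).2

lemma mk_rep {c : Cᵒᵖ} (x : (freeObj D f).obj c) : mk (rep x) (rep_refl x) = x :=
  Quotient.out_eq (s := Term.setoid f c) x

lemma rel_of_mk_eq {c : Cᵒᵖ} {t t' : D.Term f c} {h : t.Rel t} {h' : t'.Rel t'}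
    (e : mk t h = mk t' h') : t.Rel t' :=
  Quotient.exact (s := Term.setoid f c) e

lemma rep_mk {c : Cᵒᵖ} (t : D.Term f c) (h : t.Rel t) : (rep (mk t h)).Rel t :=
  rel_of_mk_eq (mk_rep _)

lemma exists_mk {c : Cᵒᵖ} (x : (freeObj D f).obj c) : ∃ t h, mk t h = x := ⟨_, _, mk_rep x⟩

lemma rep_map {c d : Cᵒᵖ} (φ : c ⟶ d) (x : (freeObj D f).obj c) :
    ((rep x).map φ).Rel (rep ((freeObj D f).map φ x)) := by
  refine rel_of_mk_eq (h := (rep_refl x).map φ) (h' := rep_refl _) ?_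
  rw [mk_rep, ← map_mk _ _ (rep_refl x), mk_rep]

variable (D f) in
/-- The inclusion of generators. -/
def incl : A ⟶ freeObj D f where
  app c := ↾fun x => mk (.gen x) (.gen x)
  naturality c d φ := by
    ext x
    rfl

variable (D f) in
/-- The projection to the base. -/
def proj : freeObj D f ⟶ X where
  app c := ↾(Quotient.lift (fun t => t.1.base) fun _ _ h => Term.Rel.base_eq h)
  naturality c d φ := by
    ext x
    obtain ⟨t, h, rfl⟩ := exists_mk x
    exact Term.base_map φ t

lemma base_rep {c : Cᵒᵖ} (x : (freeObj D f).obj c) : (rep x).base = (proj D f).app c x := by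
  conv_rhs => rw [← mk_rep x]
  rfl

/-- Representatives are chosen pointwise, so they are natural only up to `Rel`, which is all that
`Compat` requires. By the congruence rule the choice does not affect the class of a formal filler.
-/
lemma compat_rep {j : D.J} {b : D.U j ⟶ freeObj D f} {a : D.V j ⟶ X}
    (w : b ≫ proj D f = D.ι j ≫ a) : Term.Compat j (fun d y => rep (b.app d y)) a where
  nat d d' φ y := by
    rw [NatTrans.naturality_apply]
    exact rep_map φ _
  base d y := by
    rw [base_rep, ← NatTrans.comp_app_apply, w]
    rfl

/-- The formal fillers. -/
noncomputable def fill (j : D.J) (b : D.U j ⟶ freeObj D f) (a : D.V j ⟶ X)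
    (w : b ≫ proj D f = D.ι j ≫ a) : D.V j ⟶ freeObj D f where
  app c := ↾fun z => mk (.fill j (fun d y => rep (b.app d y)) a z) ((compat_rep w).fill z)
  naturality c d φ := by
    ext x
    rfl

/-- The morphism represented by a compatible family of terms. -/
def ofCompat {j : D.J} {b : ∀ d, (D.U j).obj d → D.Term f d} {a : D.V j ⟶ X}
    (h : Term.Compat j b a) : D.U j ⟶ freeObj D f where
  app c := ↾fun y => mk (b c y) (h.refl c y)
  naturality c d φ := by
    ext y
    exact (mk_eq (h.nat c d φ y)).symm

lemma ofCompat_proj {j : D.J} {b : ∀ d, (D.U j).obj d → D.Term f d} {a : D.V j ⟶ X}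
    (h : Term.Compat j b a) : ofCompat h ≫ proj D f = D.ι j ≫ a := by
  ext d y
  exact h.base d y

/-- This turns a well-formed formal filler into a chosen filler of an actual lifting problem, so
that homomorphisms can be computed on it. -/
lemma mk_fill {j : D.J} {b : ∀ d, (D.U j).obj d → D.Term f d} {a : D.V j ⟶ X}
    (h : Term.Compat j b a) {c : Cᵒᵖ} (z : (D.V j).obj c) :
    mk (.fill j b a z) (h.fill z) = (fill j (ofCompat h) a (ofCompat_proj h)).app c z :=
  (mk_eq (.fill j _ b a z (fun _ _ => rep_mk _ _) (compat_rep (ofCompat_proj h)).nat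
    (compat_rep (ofCompat_proj h)).base)).symm

variable (D f) in
/-- The filling structure on the presheaf of terms. -/
noncomputable def filling : D.Filling (proj D f) where
  fill := fill
  ι_fill j b a w := by
    ext c y
    exact (mk_eq (.boundary j _ a y (compat_rep w).nat (compat_rep w).base)).trans (mk_rep _)
  fill_comp j b a w := rfl
  natural α b a w := by
    ext c z
    exact mk_eq (.natural α _ a z (compat_rep w).nat (compat_rep w).base)
  normal j t := by
    ext c z
    refine Eq.trans (mk_eq (Term.Rel.normal j (fun d y => rep (t.app d y)) _ z ?_ ?_)) (mk_rep _)
    · intro d d' φ y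
      rw [NatTrans.naturality_apply]
      exact rep_map φ _
    · intro d z
      exact base_rep _

/-! ### Evaluation of terms and the universal property -/

section Eval

variable {Y Z : Cᵒᵖ ⥤ Type} {g : Y ⟶ Z} (s : D.Filling g) (u : A ⟶ Y) (v : X ⟶ Z)

open Classical in
/-- The partial evaluation of terms in a filling. -/
noncomputable def eval {c : Cᵒᵖ} : D.Term f c → Option (Y.obj c)
  | .gen x => some (u.app c x)
  | .fill j b a z =>
    -- Raw terms may be ill-formed, so the recursion has to test whether the values on the boundary
    -- form a lifting problem; otherwise the value is `none`.
    if h : ∃ β : D.U j ⟶ Y, (∀ d y, eval (b d y) = some (β.app d y)) ∧ β ≫ g = D.ι j ≫ a ≫ v then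
      some ((s.fill j h.choose (a ≫ v) h.choose_spec.2).app c z)
    else none

/-- The boundary values determine `β`, so the choice made in `eval` is immaterial. -/
lemma eval_fill {j : D.J} {b : ∀ d, (D.U j).obj d → D.Term f d} {a : D.V j ⟶ X}
    {β : D.U j ⟶ Y} (hβ : ∀ d y, eval s u v (b d y) = some (β.app d y))
    (w : β ≫ g = D.ι j ≫ a ≫ v) {c : Cᵒᵖ} (z : (D.V j).obj c) :
    eval s u v (.fill j b a z) = some ((s.fill j β (a ≫ v) w).app c z) := by
  have h : ∃ β : D.U j ⟶ Y, (∀ d y, eval s u v (b d y) = some (β.app d y)) ∧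
    β ≫ g = D.ι j ≫ a ≫ v := ⟨β, hβ, w⟩
  rw [eval, dif_pos h]
  have e : h.choose = β := by
    ext d y
    exact Option.some_injective _ ((h.choose_spec.1 d y).symm.trans (hβ d y))
  rw [s.fill_congr _ e rfl]

lemma eval_map {c d : Cᵒᵖ} (φ : c ⟶ d) {t : D.Term f c} {y : Y.obj c}
    (h : eval s u v t = some y) : eval s u v (t.map φ) = some (Y.map φ y) := by
  cases t with
  | gen x =>
    rw [eval, Option.some_inj] at h
    rw [Term.map, eval, ← h, NatTrans.naturality_apply]
  | fill j b a z =>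
    rw [eval] at h
    split at h
    · rename_i h'
      rw [Option.some_inj] at h
      rw [Term.map, eval, dif_pos h', ← h, NatTrans.naturality_apply]
    · cases h

variable {s u v}

/-- The values of a compatible family of terms form a morphism. -/
lemma exists_eval {j : D.J} {b : ∀ d, (D.U j).obj d → D.Term f d} {a : D.V j ⟶ X}
    (ih : ∀ d d' (φ : d ⟶ d') y, ∃ x, eval s u v ((b d y).map φ) = some x ∧
      eval s u v (b d' ((D.U j).map φ y)) = some x ∧
      g.app d' x = v.app d' ((b d y).map φ).base)
    (w : ∀ d y, (b d y).base = a.app d ((D.ι j).app d y)) :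
    ∃ β : D.U j ⟶ Y, (∀ d y, eval s u v (b d y) = some (β.app d y)) ∧
      β ≫ g = D.ι j ≫ a ≫ v := by
  have h : ∀ d y, ∃ x, eval s u v (b d y) = some x ∧ g.app d x = v.app d (b d y).base := by
    intro d y
    obtain ⟨x, h, -, h'⟩ := ih d d (𝟙 d) y
    rw [Term.map_id] at h h'
    exact ⟨x, h, h'⟩
  choose β hβ hβ' using h
  refine ⟨{ app := fun d => ↾(β d), naturality := fun d d' φ => ?_ }, hβ, ?_⟩
  · ext y
    obtain ⟨x, h, h', -⟩ := ih d d' φ y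
    have e := eval_map s u v φ (hβ d y)
    rw [hβ] at h'
    rw [h] at e
    exact Option.some_injective _ (h'.trans e)
  · ext d y
    refine (hβ' d y).trans ?_
    rw [w]
    rfl

/-- Soundness of the relation: each rule is a law that holds in the filling `s`. The statement about
the base is carried along because it provides the commuting squares needed to evaluate formal
fillers. -/
lemma exists_eval_of_rel (hw : u ≫ g = f ≫ v) {c : Cᵒᵖ} {t t' : D.Term f c} (h : t.Rel t') :
    ∃ x, eval s u v t = some x ∧ eval s u v t' = some x ∧ g.app c x = v.app c t.base := by
  induction h with
  | gen x =>
    refine ⟨u.app _ x, rfl, rfl, ?_⟩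
    rw [← NatTrans.comp_app_apply, hw]
    rfl
  | symm h ih =>
    obtain ⟨x, h₁, h₂, h₃⟩ := ih
    exact ⟨x, h₂, h₁, by rw [h₃, h.base_eq]⟩
  | trans _ _ ih ih' =>
    obtain ⟨x, h₁, h₂, h₃⟩ := ih
    obtain ⟨x', h₁', h₂', -⟩ := ih'
    rw [h₂, Option.some_inj] at h₁'
    subst h₁'
    exact ⟨x, h₁, h₂', h₃⟩
  | fill j b b' a z h nat w ih ih' =>
    obtain ⟨β, hβ, hw'⟩ := exists_eval ih' w
    refine ⟨_, eval_fill s u v hβ hw' z, eval_fill s u v (fun d y => ?_) hw' z, ?_⟩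
    · obtain ⟨x, h₁, h₂, -⟩ := ih d y
      rw [h₂, ← h₁, hβ]
    · rw [← NatTrans.comp_app_apply, s.fill_comp]
      rfl
  | boundary j b a y nat w ih =>
    obtain ⟨β, hβ, hw'⟩ := exists_eval ih w
    refine ⟨_, eval_fill s u v hβ hw' _, ?_, ?_⟩
    · rw [hβ, ← NatTrans.comp_app_apply, s.ι_fill]
    · rw [← NatTrans.comp_app_apply, s.fill_comp]
      rfl
  | natural α b a z nat w ih =>
    obtain ⟨β, hβ, hw'⟩ := exists_eval ih w
    refine ⟨_, eval_fill s u v hβ hw' _, ?_, ?_⟩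
    · rw [← NatTrans.comp_app_apply, s.natural]
      exact eval_fill s u v (β := D.uMap α ≫ β) (fun d y => hβ _ _) _ z
    · rw [← NatTrans.comp_app_apply _ g, s.fill_comp]
      rfl
  | normal j t a z nat w ih =>
    have h : ∀ d y, ∃ x, eval s u v (t d y) = some x ∧ g.app d x = v.app d (t d y).base := by
      intro d y
      obtain ⟨x, h, -, h'⟩ := ih d d (𝟙 d) y
      rw [Term.map_id] at h h'
      exact ⟨x, h, h'⟩
    choose τ hτ hτ' using h
    -- The values of `t` form an actual map out of `D.W j`, so the evaluated box is degenerate and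
    -- `s.normal` applies.
    let T : D.W j ⟶ Y :=
      { app := fun d => ↾(τ d)
        naturality := fun d d' φ => by
          ext y
          obtain ⟨x, h, h', -⟩ := ih d d' φ y
          have e := eval_map s u v φ (hτ d y)
          rw [hτ] at h'
          rw [h] at e
          exact Option.some_injective _ (h'.trans e) }
    have ha : a ≫ v = D.π j ≫ T ≫ g := by
      ext d z
      exact (congrArg (v.app d) (w d z).symm).trans (hτ' d _).symm
    have hw' : (D.ι j ≫ D.π j ≫ T) ≫ g = D.ι j ≫ a ≫ v := by
      rw [ha]
      simp only [Category.assoc]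
    have e := eval_fill (f := f) s u v (b := fun d y => t d ((D.π j).app d ((D.ι j).app d y)))
      (β := D.ι j ≫ D.π j ≫ T) (fun d y => hτ _ _) hw' z
    rw [s.fill_congr _ rfl ha, s.normal] at e
    exact ⟨_, e, hτ _ _, (hτ' _ _).trans (congrArg (v.app _) (w _ _))⟩

variable (s) in
/-- The extension of a square to the free filling. -/
noncomputable def desc (hw : u ≫ g = f ≫ v) : freeObj D f ⟶ Y where
  app c := ↾(Quotient.lift (fun t => (exists_eval_of_rel (s := s) hw t.2).choose) fun t t' h => by
    obtain ⟨x, h₁, h₂, -⟩ := exists_eval_of_rel (s := s) hw h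
    have e := (exists_eval_of_rel (s := s) hw t.2).choose_spec.1
    have e' := (exists_eval_of_rel (s := s) hw t'.2).choose_spec.1
    exact Option.some_injective _ ((e.symm.trans (h₁.trans h₂.symm)).trans e'))
  naturality c d φ := by
    ext x
    obtain ⟨t, h, rfl⟩ := exists_mk x
    have e := eval_map s u v φ (exists_eval_of_rel (s := s) hw h).choose_spec.1
    rw [(exists_eval_of_rel (s := s) hw (h.map φ)).choose_spec.1, Option.some_inj] at e
    exact e

lemma eval_eq_desc (hw : u ≫ g = f ≫ v) {c : Cᵒᵖ} (t : D.Term f c) (h : t.Rel t) :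
    eval s u v t = some ((desc s hw).app c (mk t h)) :=
  (exists_eval_of_rel hw h).choose_spec.1

lemma desc_mk (hw : u ≫ g = f ≫ v) {c : Cᵒᵖ} (t : D.Term f c) (h : t.Rel t) {x : Y.obj c}
    (hx : eval s u v t = some x) : (desc s hw).app c (mk t h) = x := by
  rw [eval_eq_desc hw t h, Option.some_inj] at hx
  exact hx

end Eval

end freeObj

open freeObj in
/-- Free fillings exist in presheaf categories. -/
noncomputable def freeFilling (f : A ⟶ X) : D.FreeFilling f where
  E := freeObj D f
  i := incl D f
  p := proj D f
  fac := rfl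
  str := filling D f
  desc s u v hw := desc s hw
  i_desc s u v hw := by
    ext c x
    exact desc_mk hw _ _ rfl
  isHom_desc {Y Z g} s u v hw := by
    have sq : desc s hw ≫ g = proj D f ≫ v := by
      ext c x
      obtain ⟨t, h, rfl⟩ := exists_mk x
      exact (exists_eval_of_rel hw h).choose_spec.2.2
    refine ⟨sq, fun j b a w => ?_⟩
    ext c z
    refine desc_mk hw _ _ (eval_fill s u v (β := b ≫ desc s hw) (fun d y => ?_) _ z)
    rw [eval_eq_desc hw _ (rep_refl _), mk_rep]
    rfl
  hom_ext {Y Z g s v v' k l} hk hl hv h := by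
    subst hv
    ext c x
    obtain ⟨t, ht, rfl⟩ := exists_mk x
    -- The proof of well-formedness is part of the induction predicate because `mk` needs it.
    have key : ∃ ht, k.app c (freeObj.mk t ht) = l.app c (freeObj.mk t ht) := by
      refine (ht.induction (P := fun {c} t => ∃ ht, k.app c (freeObj.mk t ht) = l.app c (freeObj.mk t ht))
        (fun {c} x => ?_) (fun {c} j b a z hb ih => ?_)).1
      · exact ⟨.gen x, congrArg (fun m => m.app c x) h⟩
      · refine ⟨hb.fill z, ?_⟩
        rw [mk_fill hb, ← NatTrans.comp_app_apply, ← NatTrans.comp_app_apply]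
        have e := hk.fill_comp j (ofCompat hb) a (ofCompat_proj hb)
        have e' := hl.fill_comp j (ofCompat hb) a (ofCompat_proj hb)
        have hkl : ofCompat hb ≫ k = ofCompat hb ≫ l := by
          ext d y
          exact (ih d y).2
        rw [s.fill_congr _ hkl rfl] at e
        exact congrArg (fun m => m.app c z) (e.trans e'.symm)
    exact key.2

end LiftingData

/-! ### Open boxes as lifting data -/

namespace CubicalSet

/-- The reindexings of open box problems along maps of cubes. -/
inductive BoxReindexing : ℕ × Bool × ℕ → ℕ × Bool × ℕ → Type
  | mk (n : ℕ) (e : Bool) {j k : ℕ} (α : cube j ⟶ cube k) : BoxReindexing (n, e, j) (n, e, k)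

/-- The lifting problems of generalized open boxes. -/
def boxLifting : LiftingData.{0} CubicalSet where
  J := ℕ × Bool × ℕ
  U p := cube p.2.2 ⊗ box p.1 p.2.1
  V p := cube p.2.2 ⊗ cube (p.1 + 1)
  W p := cube p.2.2 ⊗ cube p.1
  ι p := boxIncl p.2.2 p.1 p.2.1
  π p := openProj p.2.2 p.1
  H := BoxReindexing
  uMap | .mk n e α => α ▷ box n e
  vMap | .mk n e α => α ▷ cube (n + 1)
  comm | .mk n e α => (whisker_exchange α (openBox n e).ι).symm

/-- Normal Kan fibrations are fillings of generalized open boxes. -/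
def fillingEquiv {Y X : CubicalSet} (f : Y ⟶ X) : boxLifting.Filling f ≃ NormalKanFibration f where
  toFun s :=
    { fill n e k b a w := s.fill (n, e, k) b a w
      boxIncl_fill n e k b a w := s.ι_fill (n, e, k) b a w
      fill_comp n e k b a w := s.fill_comp (n, e, k) b a w
      natural n e j k α b a w := s.natural (BoxReindexing.mk n e α) b a w
      normal n e k c := s.normal (n, e, k) c }
  invFun s :=
    { fill p b a w := s.fill p.1 p.2.1 p.2.2 b a w
      ι_fill p b a w := s.boxIncl_fill p.1 p.2.1 p.2.2 b a w
      fill_comp p b a w := s.fill_comp p.1 p.2.1 p.2.2 b a w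
      natural α := by
        cases α with
        | mk n e α => exact s.natural n e _ _ α
      normal p c := s.normal p.1 p.2.1 p.2.2 c }
  left_inv s := rfl
  right_inv s := rfl

lemma fillingEquiv_isHom_iff {Y X Y' X' : CubicalSet} {f : Y ⟶ X} {f' : Y' ⟶ X'}
    (s : boxLifting.Filling f) (s' : boxLifting.Filling f') (u : Y ⟶ Y') (v : X ⟶ X')
    (h : u ≫ f' = f ≫ v) :
    s.IsHom s' u v ↔ (fillingEquiv f s).IsHom (fillingEquiv f' s') u v h :=
  ⟨fun H n e k b a w => H.fill_comp (n, e, k) b a w,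
    fun H => ⟨h, fun p b a w => H p.1 p.2.1 p.2.2 b a w⟩⟩

/-! ### Elements of products -/

section Pair

variable {F G H K : CubicalSet} {c d : Cubeᵒᵖ}

/-- The element of a product with given components. -/
def pair (x : F.obj c) (y : G.obj c) : (F ⊗ G).obj c := (x, y)

lemma map_pair (φ : c ⟶ d) (x : F.obj c) (y : G.obj c) :
    (F ⊗ G).map φ (pair x y) = pair (F.map φ x) (G.map φ y) := rfl

lemma whiskerLeft_pair (g : G ⟶ H) (x : F.obj c) (y : G.obj c) :
    (F ◁ g).app c (pair x y) = pair x (g.app c y) := rfl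

lemma whiskerRight_pair (g : F ⟶ H) (x : F.obj c) (y : G.obj c) :
    (g ▷ G).app c (pair x y) = pair (g.app c x) y := rfl

lemma fst_pair (x : F.obj c) (y : G.obj c) : (fst F G).app c (pair x y) = x := rfl

lemma snd_pair (x : F.obj c) (y : G.obj c) : (snd F G).app c (pair x y) = y := rfl

lemma lift_app (f : F ⟶ G) (g : F ⟶ H) (x : F.obj c) :
    (lift f g).app c x = pair (f.app c x) (g.app c x) := rfl

lemma exists_pair (z : (F ⊗ G).obj c) : ∃ x y, pair x y = z := ⟨z.1, z.2, rfl⟩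

lemma tensor_hom_ext {f g : F ⊗ G ⟶ H}
    (h : ∀ c (x : F.obj c) (y : G.obj c), f.app c (pair x y) = g.app c (pair x y)) : f = g := by
  ext c z
  exact h c z.1 z.2

/-- A total, functional and natural relation defines a morphism. -/
lemma exists_hom_of_rel (R : ∀ c, F.obj c → G.obj c → Prop) (total : ∀ c x, ∃ y, R c x y)
    (unique : ∀ c x y y', R c x y → R c x y' → y = y')
    (nat : ∀ c d (φ : c ⟶ d) x y, R c x y → R d (F.map φ x) (G.map φ y)) :
    ∃ m : F ⟶ G, ∀ c x y, R c x y → m.app c x = y := by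
  choose m hm using total
  refine ⟨{ app := fun c => ↾(m c), naturality := fun c d φ => ?_ },
    fun c x y h => unique c x _ _ (hm c x) h⟩
  ext x
  exact unique d _ _ _ (hm d _) (nat c d φ x _ (hm c x))

lemma exists_tensor_hom_of_rel (R : ∀ c, F.obj c → G.obj c → H.obj c → Prop)
    (total : ∀ c x y, ∃ z, R c x y z) (unique : ∀ c x y z z', R c x y z → R c x y z' → z = z')
    (nat : ∀ c d (φ : c ⟶ d) x y z, R c x y z → R d (F.map φ x) (G.map φ y) (H.map φ z)) :
    ∃ m : F ⊗ G ⟶ H, ∀ c x y z, R c x y z → m.app c (pair x y) = z := by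
  obtain ⟨m, hm⟩ := exists_hom_of_rel (F := F ⊗ G) (fun c p => R c p.1 p.2)
    (fun c p => total c p.1 p.2) (fun c p => unique c p.1 p.2) (fun c d φ p => nat c d φ p.1 p.2)
  exact ⟨m, fun c x y => hm c (pair x y)⟩

end Pair

/-! ### Coordinates of points of cubes -/

section Coord

variable {n : ℕ} {c d : Cubeᵒᵖ}

/-- The coordinates of a point of a cube. -/
def coord (τ : (cube n).obj c) (i : Fin n) : BipointedFin c.unop.dim :=
  Cube.Hom.toFun τ (.var i)

/-- The point of a cube with given coordinates. -/
def ofCoord (g : Fin n → BipointedFin c.unop.dim) : (cube n).obj c := Cube.ofCoords g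

lemma coord_ext {τ τ' : (cube n).obj c} (h : ∀ i, coord τ i = coord τ' i) : τ = τ' := by
  refine Cube.Hom.ext (funext fun y => ?_)
  cases y with
  | bot => exact (Cube.Hom.map_bot τ).trans (Cube.Hom.map_bot τ').symm
  | top => exact (Cube.Hom.map_top τ).trans (Cube.Hom.map_top τ').symm
  | var i => exact h i

lemma coord_map (φ : c ⟶ d) (τ : (cube n).obj c) (i : Fin n) :
    coord ((cube n).map φ τ) i = φ.unop.toFun (coord τ i) := rfl

lemma toFun_point {m m' : Cube} (φ : m ⟶ m') (e : Bool) :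
    φ.toFun (BipointedFin.point e) = BipointedFin.point e := by
  cases e
  · exact φ.map_bot
  · exact φ.map_top

lemma coord_map_point (φ : c ⟶ d) {τ : (cube n).obj c} {i : Fin n} {e : Bool}
    (h : coord τ i = .point e) : coord ((cube n).map φ τ) i = .point e := by
  rw [coord_map, h, toFun_point]

/-- A point lies on a face exactly when one coordinate is the corresponding endpoint; deleting that
coordinate gives its preimage under the face map. -/
lemma mem_openBox {e : Bool} (τ : (cube (n + 1)).obj c) :
    τ ∈ (openBox n e).obj c ↔ ∃ i d, (i, d) ≠ (0, e) ∧ coord τ i = .point d := by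
  simp only [openBox, Subfunctor.iSup_obj, Set.mem_iUnion]
  constructor
  · rintro ⟨⟨i, d⟩, h, σ, rfl⟩
    refine ⟨i, d, h, ?_⟩
    have : (Cube.face i d).toFun (.var i) = .point d := by
      simp [Cube.face, Cube.ofCoords, BipointedFin.elim]
    change Cube.Hom.toFun σ ((Cube.face i d).toFun (.var i)) = _
    rw [this]
    exact toFun_point (m := c.unop) (m' := Cube.mk n) σ d
  · rintro ⟨i, d, h, hτ⟩
    refine ⟨(i, d), h, ofCoord fun j => coord τ (i.succAbove j), coord_ext fun l => ?_⟩
    obtain rfl | ⟨j, rfl⟩ := i.eq_self_or_eq_succAbove l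
    · have : (Cube.face l d).toFun (.var l) = .point d := by
        simp [Cube.face, Cube.ofCoords, BipointedFin.elim]
      rw [hτ]
      refine Eq.trans (congrArg (Cube.Hom.toFun (ofCoord fun j => coord τ (l.succAbove j))) this) ?_
      exact toFun_point (m := c.unop) (m' := Cube.mk n) _ d
    · have : (Cube.face i d).toFun (.var (i.succAbove j)) = .var j := by
        simp [Cube.face, Cube.ofCoords, BipointedFin.elim]
      exact congrArg (Cube.Hom.toFun (ofCoord fun j => coord τ (i.succAbove j))) this

variable (n) in
/-- The projection that forgets the last coordinate. -/
def initMap : cube (n + 1) ⟶ cube n := yoneda.map (Cube.ofCoords fun i => .var i.castSucc)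

variable (n) in
/-- The projection to the last coordinate. -/
def lastMap : cube (n + 1) ⟶ cube 1 := yoneda.map (Cube.ofCoords fun _ => .var (Fin.last n))

/-- The point of a cube with an additional last coordinate. -/
def snoc (t : (cube 1).obj c) (τ : (cube n).obj c) : (cube (n + 1)).obj c :=
  ofCoord (Fin.snoc (α := fun _ => BipointedFin c.unop.dim) (coord τ) (coord t 0))

lemma coord_snoc_castSucc (t : (cube 1).obj c) (τ : (cube n).obj c) (i : Fin n) :
    coord (snoc t τ) i.castSucc = coord τ i :=
  Fin.snoc_castSucc (α := fun _ => BipointedFin c.unop.dim) _ _ _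

lemma coord_snoc_last (t : (cube 1).obj c) (τ : (cube n).obj c) :
    coord (snoc t τ) (Fin.last n) = coord t 0 :=
  Fin.snoc_last (α := fun _ => BipointedFin c.unop.dim) _ _

lemma map_snoc (φ : c ⟶ d) (t : (cube 1).obj c) (τ : (cube n).obj c) :
    (cube (n + 1)).map φ (snoc t τ) = snoc ((cube 1).map φ t) ((cube n).map φ τ) := by
  refine coord_ext fun i => ?_
  induction i using Fin.lastCases with
  | last => rw [coord_map, coord_snoc_last, coord_snoc_last, coord_map]
  | cast i => rw [coord_map, coord_snoc_castSucc, coord_snoc_castSucc, coord_map]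

lemma coord_initMap (τ : (cube (n + 1)).obj c) (i : Fin n) :
    coord ((initMap n).app c τ) i = coord τ i.castSucc := rfl

lemma coord_lastMap (τ : (cube (n + 1)).obj c) (i : Fin 1) :
    coord ((lastMap n).app c τ) i = coord τ (Fin.last n) := rfl

lemma initMap_snoc (t : (cube 1).obj c) (τ : (cube n).obj c) :
    (initMap n).app c (snoc t τ) = τ :=
  coord_ext fun i => coord_snoc_castSucc t τ i

lemma lastMap_snoc (t : (cube 1).obj c) (τ : (cube n).obj c) :
    (lastMap n).app c (snoc t τ) = t :=
  coord_ext fun i => by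
    rw [coord_lastMap, coord_snoc_last, Fin.fin_one_eq_zero i]

lemma map_mem_openBox {e : Bool} (φ : c ⟶ d) {τ : (cube (n + 1)).obj c}
    (h : τ ∈ (openBox n e).obj c) : (cube (n + 1)).map φ τ ∈ (openBox n e).obj d :=
  (openBox n e).map φ h

/-- This is the decomposition of a box as (smaller box) × I ∪ cube × ∂I. The new coordinate is the
last one, since the first is the open direction. -/
lemma mem_openBox_succ {e : Bool} (τ : (cube (n + 2)).obj c) :
    τ ∈ (openBox (n + 1) e).obj c ↔ (initMap (n + 1)).app c τ ∈ (openBox n e).obj c ∨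
      ∃ d, coord ((lastMap (n + 1)).app c τ) 0 = .point d := by
  rw [mem_openBox, mem_openBox]
  constructor
  · rintro ⟨i, d, h, hτ⟩
    induction i using Fin.lastCases with
    | last => exact .inr ⟨d, hτ⟩
    | cast i =>
      refine .inl ⟨i, d, fun h' => h ?_, hτ⟩
      simp only [Prod.mk.injEq] at h' ⊢
      exact ⟨by rw [h'.1]; rfl, h'.2⟩
  · rintro (⟨i, d, h, hτ⟩ | ⟨d, hτ⟩)
    · refine ⟨i.castSucc, d, fun h' => h ?_, hτ⟩
      simp only [Prod.mk.injEq] at h' ⊢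
      exact ⟨Fin.castSucc_injective _ h'.1, h'.2⟩
    -- In dimension at least two the last coordinate is not the first, so neither of its faces is
    -- the missing one.
    · refine ⟨Fin.last _, d, fun h' => ?_, hτ⟩
      simp only [Prod.mk.injEq] at h'
      exact Fin.last_pos.ne' h'.1

lemma mem_openBox_zero {e : Bool} (τ : (cube 1).obj c) :
    τ ∈ (openBox 0 e).obj c ↔ coord τ 0 = .point (!e) := by
  rw [mem_openBox]
  constructor
  · rintro ⟨i, d, h, hτ⟩
    obtain rfl : i = 0 := Fin.fin_one_eq_zero i
    rw [hτ]
    cases d <;> cases e <;> simp_all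
  · intro h
    exact ⟨0, !e, by cases e <;> simp, h⟩

/-- The endpoints of the interval, as points over `c`. -/
def pt (c : Cubeᵒᵖ) (e : Bool) : (cube 1).obj c := ofCoord fun _ => .point e

lemma eq_pt {τ : (cube 1).obj c} {e : Bool} (h : coord τ 0 = .point e) : τ = pt c e :=
  coord_ext fun i => by rw [Fin.fin_one_eq_zero i, h]; rfl

lemma map_pt (φ : c ⟶ d) (e : Bool) : (cube 1).map φ (pt c e) = pt d e :=
  eq_pt (coord_map_point φ rfl)

end Coord

/-! ### Fillers over arbitrary bases -/

section FillAt

variable {B : CubicalSet} {c d : Cubeᵒᵖ}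

/-- The map from a cube that classifies an element. -/
def elt (x : B.obj c) : cube c.unop.dim ⟶ B := (yonedaEquiv (X := c.unop)).symm x

lemma elt_map (φ : c ⟶ d) (x : B.obj c) : elt (B.map φ x) = yoneda.map φ.unop ≫ elt x :=
  yonedaEquiv_symm_map φ x

lemma elt_comp {B' : CubicalSet} (β : B ⟶ B') (x : B.obj c) : elt x ≫ β = elt (β.app c x) :=
  yonedaEquiv_symm_naturality_right c.unop β x

lemma elt_app_id (x : B.obj c) : (elt x).app c (𝟙 c.unop) = x := by
  change B.map (𝟙 c) x = x
  rw [Functor.map_id_apply]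

variable {Y X : CubicalSet} {f : Y ⟶ X}

lemma UniformKanFibration.fill_congr (s : UniformKanFibration f) {n : ℕ} {e : Bool} {k : ℕ}
    {b b' : cube k ⊗ box n e ⟶ Y} {a a' : cube k ⊗ cube (n + 1) ⟶ X}
    (w : b ≫ f = boxIncl k n e ≫ a) (hb : b = b') (ha : a = a') :
    s.fill n e k b a w = s.fill n e k b' a' (by rw [← hb, ← ha, w]) := by
  subst hb ha; rfl

/-- The chosen fillers of open boxes parametrized by an arbitrary cubical set `B`. -/
def UniformKanFibration.fillAt (s : UniformKanFibration f) (n : ℕ) (e : Bool)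
    (b : B ⊗ box n e ⟶ Y) (a : B ⊗ cube (n + 1) ⟶ X) (w : b ≫ f = B ◁ (openBox n e).ι ≫ a) :
    B ⊗ cube (n + 1) ⟶ Y where
  app c := ↾fun z => (s.fill n e c.unop.dim (elt z.1 ▷ _ ≫ b) (elt z.1 ▷ _ ≫ a)
    (by rw [Category.assoc, w, whisker_exchange_assoc])).app c (pair (𝟙 c.unop) z.2)
  naturality c d φ := by
    refine ConcreteCategory.hom_ext _ _ fun z => ?_
    obtain ⟨x, z, rfl⟩ := exists_pair z
    have h : elt (B.map φ x) = yoneda.map φ.unop ≫ elt x := elt_map φ x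
    -- Naturality in the stage is precisely uniformity along maps of cubes.
    have hn := s.natural n e d.unop.dim c.unop.dim (yoneda.map φ.unop) (elt x ▷ _ ≫ b)
      (elt x ▷ _ ≫ a) (by rw [Category.assoc, w, whisker_exchange_assoc])
    have hc : s.fill n e d.unop.dim (elt (B.map φ x) ▷ _ ≫ b) (elt (B.map φ x) ▷ _ ≫ a)
        (by rw [Category.assoc, w, whisker_exchange_assoc]) = _ :=
      (s.fill_congr _ (by rw [h, comp_whiskerRight, Category.assoc])
        (by rw [h, comp_whiskerRight, Category.assoc])).trans hn.symm
    change (s.fill n e d.unop.dim (elt (B.map φ x) ▷ _ ≫ b) (elt (B.map φ x) ▷ _ ≫ a) _).app d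
      (pair (𝟙 d.unop) ((cube (n + 1)).map φ z)) = Y.map φ ((s.fill n e c.unop.dim _ _ _).app c
        (pair (𝟙 c.unop) z))
    rw [hc, ← NatTrans.naturality_apply, map_pair, NatTrans.comp_app_apply, whiskerRight_pair]
    congr 2

lemma UniformKanFibration.fillAt_pair (s : UniformKanFibration f) (n : ℕ) (e : Bool)
    (b : B ⊗ box n e ⟶ Y) (a : B ⊗ cube (n + 1) ⟶ X) (w : b ≫ f = B ◁ (openBox n e).ι ≫ a)
    (x : B.obj c) (z : (cube (n + 1)).obj c) :
    (s.fillAt n e b a w).app c (pair x z) =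
      (s.fill n e c.unop.dim (elt x ▷ _ ≫ b) (elt x ▷ _ ≫ a)
        (by rw [Category.assoc, w, whisker_exchange_assoc])).app c (pair (𝟙 c.unop) z) := rfl

lemma UniformKanFibration.fillAt_box (s : UniformKanFibration f) (n : ℕ) (e : Bool)
    (b : B ⊗ box n e ⟶ Y) (a : B ⊗ cube (n + 1) ⟶ X) (w : b ≫ f = B ◁ (openBox n e).ι ≫ a)
    (x : B.obj c) (z : (box n e).obj c) :
    (s.fillAt n e b a w).app c (pair x z.1) = b.app c (pair x z) := by
  rw [fillAt_pair]
  have h := s.boxIncl_fill n e c.unop.dim (elt x ▷ _ ≫ b) (elt x ▷ _ ≫ a)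
    (by rw [Category.assoc, w, whisker_exchange_assoc])
  refine (congrArg (fun m => m.app c (pair (𝟙 c.unop) z)) h).trans ?_
  rw [NatTrans.comp_app_apply, whiskerRight_pair, elt_app_id]

lemma UniformKanFibration.fillAt_comp (s : UniformKanFibration f) (n : ℕ) (e : Bool)
    (b : B ⊗ box n e ⟶ Y) (a : B ⊗ cube (n + 1) ⟶ X) (w : b ≫ f = B ◁ (openBox n e).ι ≫ a) :
    s.fillAt n e b a w ≫ f = a := by
  refine tensor_hom_ext fun c x z => ?_
  rw [NatTrans.comp_app_apply, fillAt_pair, ← NatTrans.comp_app_apply, s.fill_comp,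
    NatTrans.comp_app_apply, whiskerRight_pair, elt_app_id]

/-- A box whose restriction to one parameter is degenerate has a degenerate filler there. -/
lemma NormalKanFibration.fillAt_degenerate (s : NormalKanFibration f) (n : ℕ) (e : Bool)
    (b : B ⊗ box n e ⟶ Y) (a : B ⊗ cube (n + 1) ⟶ X) (w : b ≫ f = B ◁ (openBox n e).ι ≫ a)
    {B' : CubicalSet} (β : B' ⟶ B) (t : B' ⊗ cube n ⟶ Y)
    (hb : β ▷ _ ≫ b = B' ◁ (openBox n e).ι ≫ B' ◁ yoneda.map (Cube.proj n) ≫ t)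
    (ha : β ▷ _ ≫ a = B' ◁ yoneda.map (Cube.proj n) ≫ t ≫ f) :
    β ▷ _ ≫ s.fillAt n e b a w = B' ◁ yoneda.map (Cube.proj n) ≫ t := by
  refine tensor_hom_ext fun c x z => ?_
  rw [NatTrans.comp_app_apply, whiskerRight_pair, UniformKanFibration.fillAt_pair]
  have h := s.normal n e c.unop.dim (elt x ▷ _ ≫ t)
  have e₁ : elt (β.app c x) ▷ _ ≫ b = boxIncl c.unop.dim n e ≫ openProj c.unop.dim n ≫
      elt x ▷ _ ≫ t := by
    rw [← elt_comp, comp_whiskerRight, Category.assoc, hb, whisker_exchange_assoc,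
      whisker_exchange_assoc]
  have e₂ : elt (β.app c x) ▷ _ ≫ a = openProj c.unop.dim n ≫ (elt x ▷ _ ≫ t) ≫ f := by
    rw [← elt_comp, comp_whiskerRight, Category.assoc, ha, Category.assoc,
      whisker_exchange_assoc]
  rw [s.fill_congr _ e₁ e₂, h, NatTrans.comp_app_apply, whiskerLeft_pair, NatTrans.comp_app_apply,
    whiskerRight_pair, elt_app_id]
  rfl

end FillAt

/-! ### Path objects -/

section Path

variable {A F : CubicalSet} {c d : Cubeᵒᵖ}

/-- The value of a path at a point of the interval. -/
noncomputable def valueAt (p : (pathObject A).obj c) (t : (cube 1).obj c) : A.obj c :=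
  ((ihom.ev (cube 1)).app A).app c (pair (G := pathObject A) t p)

lemma map_valueAt (φ : c ⟶ d) (p : (pathObject A).obj c) (t : (cube 1).obj c) :
    A.map φ (valueAt p t) = valueAt ((pathObject A).map φ p) ((cube 1).map φ t) :=
  (NatTrans.naturality_apply ((ihom.ev (cube 1)).app A) φ (pair (G := pathObject A) t p)).symm

lemma valueAt_curry (g : cube 1 ⊗ F ⟶ A) (x : F.obj c) (t : (cube 1).obj c) :
    valueAt ((MonoidalClosed.curry g).app c x) t = g.app c (pair t x) := by
  have h := MonoidalClosed.uncurry_curry g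
  rw [MonoidalClosed.uncurry_eq] at h
  exact congrArg (fun m => m.app c (pair t x)) h

lemma path_hom_ext {f g : F ⟶ pathObject A}
    (h : ∀ c (x : F.obj c) t, valueAt (f.app c x) t = valueAt (g.app c x) t) : f = g := by
  apply MonoidalClosed.uncurry_injective
  rw [MonoidalClosed.uncurry_eq, MonoidalClosed.uncurry_eq]
  exact tensor_hom_ext fun c t x => h c x t

lemma valueAt_constPath (a : A.obj c) (t : (cube 1).obj c) :
    valueAt ((constPath A).app c a) t = a :=
  valueAt_curry _ _ _

lemma evalAt_app (e : Bool) (p : (pathObject A).obj c) :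
    (evalAt A e).app c p = valueAt p (pt c e) := rfl

/-- The projections of `A ⊗ A` indexed by the endpoints. -/
def projAt (A : CubicalSet) : Bool → (A ⊗ A ⟶ A)
  | false => fst A A
  | true => snd A A

lemma endpoints_projAt (e : Bool) : endpoints A ≫ projAt A e = evalAt A e := by
  cases e
  · exact lift_fst _ _
  · exact lift_snd _ _

lemma hom_ext_projAt {f g : F ⟶ A ⊗ A} (h : ∀ e, f ≫ projAt A e = g ≫ projAt A e) : f = g :=
  CartesianMonoidalCategory.hom_ext _ _ (h false) (h true)

/-- An open box of paths, with prescribed endpoints of the fillers, is an open box of one dimension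
more. -/
lemma exists_pathBox {B : CubicalSet} {n : ℕ} {e : Bool} (b : B ⊗ box n e ⟶ pathObject A)
    (a : B ⊗ cube (n + 1) ⟶ A ⊗ A) (w : b ≫ endpoints A = B ◁ (openBox n e).ι ≫ a) :
    ∃ m : B ⊗ box (n + 1) e ⟶ A, ∀ c (x : B.obj c) (τ : (box (n + 1) e).obj c),
      (∀ h : (initMap (n + 1)).app c τ.1 ∈ (openBox n e).obj c,
        m.app c (pair x τ) = valueAt (b.app c (pair x ⟨_, h⟩)) ((lastMap (n + 1)).app c τ.1)) ∧
      ∀ d, coord ((lastMap (n + 1)).app c τ.1) 0 = .point d →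
        m.app c (pair x τ) = (a ≫ projAt A d).app c (pair x ((initMap (n + 1)).app c τ.1)) := by
  -- The two pieces of the larger box overlap where a point of the smaller box meets an endpoint of
  -- the path; there the commuting square `w` makes the prescriptions agree.
  have agree : ∀ {c} (x : B.obj c) (z : (box n e).obj c) d,
      valueAt (b.app c (pair x z)) (pt c d) = (a ≫ projAt A d).app c (pair x z.1) := by
    intro c x z d
    have h : b ≫ evalAt A d = B ◁ (openBox n e).ι ≫ a ≫ projAt A d := by
      rw [← endpoints_projAt, ← Category.assoc, w, Category.assoc]
    exact congrArg (fun m => m.app c (pair x z)) h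
  obtain ⟨m, hm⟩ := exists_tensor_hom_of_rel (F := B) (G := box (n + 1) e) (H := A)
    (fun c x τ y => (∃ h : (initMap (n + 1)).app c τ.1 ∈ (openBox n e).obj c,
        y = valueAt (b.app c (pair x ⟨_, h⟩)) ((lastMap (n + 1)).app c τ.1)) ∨
      ∃ d, coord ((lastMap (n + 1)).app c τ.1) 0 = .point d ∧
        y = (a ≫ projAt A d).app c (pair x ((initMap (n + 1)).app c τ.1)))
    (fun c x τ => by
      rcases (mem_openBox_succ τ.1).1 τ.2 with h | ⟨d, h⟩
      · exact ⟨_, .inl ⟨h, rfl⟩⟩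
      · exact ⟨_, .inr ⟨d, h, rfl⟩⟩)
    (fun c x τ y y' => by
      rintro (⟨h, rfl⟩ | ⟨d, h, rfl⟩) (⟨h', rfl⟩ | ⟨d', h', rfl⟩)
      · rfl
      · rw [eq_pt h']
        exact agree x ⟨_, h⟩ d'
      · rw [eq_pt h]
        exact (agree x ⟨_, h'⟩ d).symm
      · rw [h] at h'
        cases d <;> cases d' <;> first | rfl | cases h')
    (fun c d φ x τ y => by
      have hi : (initMap (n + 1)).app d ((box (n + 1) e).map φ τ).1 =
        (cube (n + 1)).map φ ((initMap (n + 1)).app c τ.1) :=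
          NatTrans.naturality_apply (initMap (n + 1)) φ τ.1
      have hl : (lastMap (n + 1)).app d ((box (n + 1) e).map φ τ).1 =
        (cube 1).map φ ((lastMap (n + 1)).app c τ.1) :=
          NatTrans.naturality_apply (lastMap (n + 1)) φ τ.1
      rintro (⟨h, rfl⟩ | ⟨e', h, rfl⟩)
      · refine .inl ⟨by rw [hi]; exact map_mem_openBox φ h, ?_⟩
        rw [map_valueAt, ← NatTrans.naturality_apply, hl]
        congr 2
      · refine .inr ⟨e', by rw [hl]; exact coord_map_point φ h, ?_⟩
        rw [← NatTrans.naturality_apply, map_pair, hi])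
  exact ⟨m, fun c x τ => ⟨fun h => hm _ _ _ _ (.inl ⟨h, rfl⟩),
    fun d h => hm _ _ _ _ (.inr ⟨d, h, rfl⟩)⟩⟩

end Path

/-! ### The path object factorization -/

section PathFibration

variable {A B B' : CubicalSet} {c d : Cubeᵒᵖ} {n : ℕ} {e : Bool}

/-- The open box of dimension one more that is given by an open box of paths. -/
noncomputable def pathBox (b : B ⊗ box n e ⟶ pathObject A)
    (a : B ⊗ cube (n + 1) ⟶ A ⊗ A) (w : b ≫ endpoints A = B ◁ (openBox n e).ι ≫ a) :
    B ⊗ box (n + 1) e ⟶ A :=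
  (exists_pathBox b a w).choose

lemma pathBox_snoc (b : B ⊗ box n e ⟶ pathObject A)
    (a : B ⊗ cube (n + 1) ⟶ A ⊗ A) (w : b ≫ endpoints A = B ◁ (openBox n e).ι ≫ a)
    (x : B.obj c) (z : (box n e).obj c) (t : (cube 1).obj c)
    (h : snoc t z.1 ∈ (openBox (n + 1) e).obj c) :
    (pathBox b a w).app c (pair x ⟨snoc t z.1, h⟩) = valueAt (b.app c (pair x z)) t := by
  have h' : (initMap (n + 1)).app c (snoc t z.1) ∈ (openBox n e).obj c := by
    rw [initMap_snoc]
    exact z.2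
  refine (((exists_pathBox b a w).choose_spec c x ⟨snoc t z.1, h⟩).1 h').trans ?_
  congr 1
  · congr 2
    exact Subtype.ext (initMap_snoc t z.1)
  · exact lastMap_snoc t z.1

lemma pathBox_snoc_pt (b : B ⊗ box n e ⟶ pathObject A)
    (a : B ⊗ cube (n + 1) ⟶ A ⊗ A) (w : b ≫ endpoints A = B ◁ (openBox n e).ι ≫ a)
    (x : B.obj c) (z : (cube (n + 1)).obj c) (d : Bool)
    (h : snoc (pt c d) z ∈ (openBox (n + 1) e).obj c) :
    (pathBox b a w).app c (pair x ⟨snoc (pt c d) z, h⟩) = (a ≫ projAt A d).app c (pair x z) := by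
  refine (((exists_pathBox b a w).choose_spec c x ⟨_, h⟩).2 d ?_).trans ?_
  · rw [lastMap_snoc]
    rfl
  · rw [initMap_snoc]

lemma snoc_init_last (τ : (cube (n + 1)).obj c) :
    snoc ((lastMap n).app c τ) ((initMap n).app c τ) = τ := by
  refine coord_ext fun i => ?_
  induction i using Fin.lastCases with
  | last => rw [coord_snoc_last, coord_lastMap]
  | cast i => rw [coord_snoc_castSucc, coord_initMap]

lemma snoc_mem_of_mem {z : (cube (n + 1)).obj c} (t : (cube 1).obj c)
    (h : z ∈ (openBox n e).obj c) : snoc t z ∈ (openBox (n + 1) e).obj c := by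
  rw [mem_openBox_succ, initMap_snoc]
  exact .inl h

lemma snoc_pt_mem (z : (cube (n + 1)).obj c) (d : Bool) :
    snoc (pt c d) z ∈ (openBox (n + 1) e).obj c := by
  rw [mem_openBox_succ, lastMap_snoc]
  exact .inr ⟨d, rfl⟩

lemma box_succ_hom_ext {f g : B ⊗ box (n + 1) e ⟶ A}
    (h : ∀ c (x : B.obj c) (z : (box n e).obj c) t,
      f.app c (pair x ⟨snoc t z.1, snoc_mem_of_mem t z.2⟩) =
        g.app c (pair x ⟨snoc t z.1, snoc_mem_of_mem t z.2⟩))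
    (h' : ∀ c (x : B.obj c) (z : (cube (n + 1)).obj c) d,
      f.app c (pair x ⟨snoc (pt c d) z, snoc_pt_mem z d⟩) =
        g.app c (pair x ⟨snoc (pt c d) z, snoc_pt_mem z d⟩)) : f = g := by
  refine tensor_hom_ext fun c x τ => ?_
  obtain ⟨τ, hτ⟩ := τ
  obtain ⟨t, z, rfl⟩ : ∃ t z, snoc t z = τ := ⟨_, _, snoc_init_last τ⟩
  have H := (mem_openBox_succ _).1 hτ
  rw [initMap_snoc, lastMap_snoc] at H
  rcases H with H | ⟨d, H⟩
  · exact h c x ⟨z, H⟩ t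
  · obtain rfl := eq_pt H
    exact h' c x z d

lemma pathBox_comp (β : B' ⟶ B) (b : B ⊗ box n e ⟶ pathObject A)
    (a : B ⊗ cube (n + 1) ⟶ A ⊗ A) (w : b ≫ endpoints A = B ◁ (openBox n e).ι ≫ a) :
    β ▷ _ ≫ pathBox b a w = pathBox (β ▷ _ ≫ b) (β ▷ _ ≫ a)
      (by rw [Category.assoc, w, whisker_exchange_assoc]) := by
  refine box_succ_hom_ext (fun c x z t => ?_) fun c x z d => ?_
  · exact (pathBox_snoc b a w (β.app c x) z t _).trans (pathBox_snoc (β ▷ _ ≫ b) (β ▷ _ ≫ a) _ x z t _).symm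
  · exact (pathBox_snoc_pt b a w (β.app c x) z d _).trans (pathBox_snoc_pt (β ▷ _ ≫ b) (β ▷ _ ≫ a) _ x z d _).symm

variable (B n) in
/-- The map that appends a point of the interval to a cube. -/
def snocMap : cube 1 ⊗ (B ⊗ cube n) ⟶ B ⊗ cube (n + 1) where
  app c := ↾fun p => pair p.2.1 (snoc p.1 p.2.2)
  naturality c d φ := by
    refine ConcreteCategory.hom_ext _ _ fun p => ?_
    exact congrArg (pair _) (map_snoc φ p.1 p.2.2).symm

/-- Forgetting the first coordinate commutes with appending a last one. This is what carries
degenerate boxes of paths to degenerate boxes in A. -/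
lemma proj_snoc (t : (cube 1).obj c) (z : (cube (n + 1)).obj c) :
    (yoneda.map (Cube.proj (n + 1))).app c (snoc t z) =
      snoc t ((yoneda.map (Cube.proj n)).app c z) := by
  refine coord_ext fun i => ?_
  change coord (snoc t z) i.succ = _
  induction i using Fin.lastCases with
  | last => rw [Fin.succ_last, coord_snoc_last, coord_snoc_last]
  | cast i => rw [← Fin.castSucc_succ, coord_snoc_castSucc, coord_snoc_castSucc]; rfl

/-- The filler of an open box of paths. -/
noncomputable def fillPath (s : NormalKanFibration (toUnit A)) (n : ℕ) (e : Bool) (k : ℕ)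
    (b : cube k ⊗ box n e ⟶ pathObject A) (a : cube k ⊗ cube (n + 1) ⟶ A ⊗ A)
    (w : b ≫ endpoints A = boxIncl k n e ≫ a) : cube k ⊗ cube (n + 1) ⟶ pathObject A :=
  MonoidalClosed.curry (snocMap (cube k) (n + 1) ≫
    s.fill (n + 1) e k (pathBox b a w) (toUnit _) (toUnit_unique _ _))

lemma valueAt_fillPath (s : NormalKanFibration (toUnit A)) (n : ℕ) (e : Bool) (k : ℕ)
    (b : cube k ⊗ box n e ⟶ pathObject A) (a : cube k ⊗ cube (n + 1) ⟶ A ⊗ A)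
    (w : b ≫ endpoints A = boxIncl k n e ≫ a) (x : (cube k).obj c) (z : (cube (n + 1)).obj c)
    (t : (cube 1).obj c) :
    valueAt ((fillPath s n e k b a w).app c (pair x z)) t =
      (s.fill (n + 1) e k (pathBox b a w) (toUnit _) (toUnit_unique _ _)).app c
        (pair x (snoc t z)) :=
  valueAt_curry _ _ _

lemma UniformKanFibration.fill_box {Y X : CubicalSet} {f : Y ⟶ X} (s : UniformKanFibration f)
    {k : ℕ} (b : cube k ⊗ box n e ⟶ Y) (a : cube k ⊗ cube (n + 1) ⟶ X)
    (w : b ≫ f = boxIncl k n e ≫ a) (x : (cube k).obj c) {z : (cube (n + 1)).obj c}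
    (h : z ∈ (openBox n e).obj c) :
    (s.fill n e k b a w).app c (pair x z) = b.app c (pair x ⟨z, h⟩) :=
  congrArg (fun m => m.app c (pair x ⟨z, h⟩)) (s.boxIncl_fill n e k b a w)

/-- The endpoint map of the path object of a normal Kan complex is a normal Kan fibration. -/
noncomputable def endpointsFibration (s : NormalKanFibration (toUnit A)) :
    NormalKanFibration (endpoints A) where
  fill := fillPath s
  boxIncl_fill n e k b a w := by
    refine path_hom_ext fun c p t => ?_
    obtain ⟨x, z, rfl⟩ := exists_pair p
    rw [NatTrans.comp_app_apply, whiskerLeft_pair]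
    change valueAt ((fillPath s n e k b a w).app c (pair x z.1)) t = _
    rw [valueAt_fillPath, s.fill_box _ _ _ _ (snoc_mem_of_mem t z.2)]
    exact pathBox_snoc _ _ _ _ _ _ _
  fill_comp n e k b a w := by
    refine hom_ext_projAt fun d => ?_
    rw [Category.assoc, endpoints_projAt]
    refine tensor_hom_ext fun c x z => ?_
    rw [NatTrans.comp_app_apply, evalAt_app, valueAt_fillPath,
      s.fill_box _ _ _ _ (snoc_pt_mem z d)]
    exact pathBox_snoc_pt _ _ _ _ _ _ _
  natural n e j k α b a w := by
    refine path_hom_ext fun c p t => ?_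
    obtain ⟨x, z, rfl⟩ := exists_pair p
    rw [NatTrans.comp_app_apply, whiskerRight_pair, valueAt_fillPath, valueAt_fillPath]
    have h := s.natural (n + 1) e j k α (pathBox b a w) (toUnit _) (toUnit_unique _ _)
    refine (congrArg (fun m => m.app c (pair x (snoc t z))) h).trans ?_
    rw [s.fill_congr _ (pathBox_comp α b a w) (toUnit_unique _ _)]
  normal n e k q := by
    -- The transpose of `q`, with the path parameter as last coordinate; the box in A is then the
    -- degenerate box on `q'`.
    let q' : cube k ⊗ cube (n + 1) ⟶ A :=
      lift (snd _ _ ≫ lastMap n) (cube k ◁ initMap n) ≫ MonoidalClosed.uncurry q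
    have hq' : ∀ {c} (x : (cube k).obj c) (z : (cube n).obj c) t,
        q'.app c (pair x (snoc t z)) = valueAt (q.app c (pair x z)) t := by
      intro c x z t
      rw [NatTrans.comp_app_apply, lift_app, NatTrans.comp_app_apply, snd_pair, whiskerLeft_pair,
        initMap_snoc, lastMap_snoc, MonoidalClosed.uncurry_eq]
      rfl
    refine path_hom_ext fun c p t => ?_
    obtain ⟨x, z, rfl⟩ := exists_pair p
    rw [valueAt_fillPath]
    have e₁ : pathBox (boxIncl k n e ≫ openProj k n ≫ q) (openProj k n ≫ q ≫ endpoints A)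
        (by simp only [Category.assoc]) = boxIncl k (n + 1) e ≫ openProj k (n + 1) ≫ q' := by
      refine box_succ_hom_ext (fun c x z t => ?_) fun c x z d => ?_
      · rw [pathBox_snoc]
        change _ = q'.app c (pair x ((yoneda.map (Cube.proj (n + 1))).app c (snoc t z.1)))
        rw [proj_snoc, hq']
        rfl
      · rw [pathBox_snoc_pt, Category.assoc, Category.assoc, endpoints_projAt]
        change _ = q'.app c (pair x ((yoneda.map (Cube.proj (n + 1))).app c (snoc (pt c d) z)))
        rw [proj_snoc, hq']
        rfl
    rw [s.fill_congr _ e₁ (toUnit_unique _ (openProj k (n + 1) ≫ q' ≫ toUnit A)), s.normal,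
      NatTrans.comp_app_apply, whiskerLeft_pair, proj_snoc, hq']
    rfl

/-- A normal Kan complex has the contractions of its paths to their starting points: a map
`A^I × I ⟶ A^I` from the constant path at the starting point to the identity that is constant on
constant paths. -/
lemma exists_contraction (s : NormalKanFibration (toUnit A)) :
    ∃ h : pathObject A ⊗ cube 1 ⟶ pathObject A,
      lift (𝟙 _) (toUnit _ ≫ endpoint false) ≫ h = evalAt A false ≫ constPath A ∧
      lift (𝟙 _) (toUnit _ ≫ endpoint true) ≫ h = 𝟙 _ ∧
      constPath A ▷ cube 1 ≫ h = fst A (cube 1) ≫ constPath A := by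
  -- The box in the square with open face x₁ = 1: the path p(x₁) on x₂ = 1, and the constant p(0) on
  -- x₁ = 0 and on x₂ = 0. A filler plays the role of a connection.
  obtain ⟨b, hb⟩ := exists_tensor_hom_of_rel (F := pathObject A) (G := box 1 true) (H := A)
    (fun c p τ x => ((lastMap 1).app c τ.1 = pt c true ∧ x = valueAt p ((initMap 1).app c τ.1)) ∨
      (((lastMap 1).app c τ.1 = pt c false ∨ (initMap 1).app c τ.1 = pt c false) ∧
        x = valueAt p (pt c false)))
    (fun c p τ => by
      rcases (mem_openBox_succ τ.1).1 τ.2 with h | ⟨_ | _, h⟩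
      · exact ⟨_, .inr ⟨.inr (eq_pt ((mem_openBox_zero _).1 h)), rfl⟩⟩
      · exact ⟨_, .inr ⟨.inl (eq_pt h), rfl⟩⟩
      · exact ⟨_, .inl ⟨eq_pt h, rfl⟩⟩)
    (fun c p τ x y => by
      have hne : pt c true ≠ pt c false := by
        intro h
        have := congrArg (fun t => coord t 0) h
        cases this
      rintro (⟨h, rfl⟩ | ⟨h, rfl⟩) (⟨h', rfl⟩ | ⟨h', rfl⟩)
      · rfl
      · rcases h' with h' | h'
        · exact absurd (h.symm.trans h') hne
        · rw [h']
      · rcases h with h | h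
        · exact absurd (h'.symm.trans h) hne
        · rw [h]
      · rfl)
    (fun c d φ p τ x => by
      have hi : (initMap 1).app d ((box 1 true).map φ τ).1 =
        (cube 1).map φ ((initMap 1).app c τ.1) := NatTrans.naturality_apply (initMap 1) φ τ.1
      have hl : (lastMap 1).app d ((box 1 true).map φ τ).1 =
        (cube 1).map φ ((lastMap 1).app c τ.1) := NatTrans.naturality_apply (lastMap 1) φ τ.1
      rw [hi, hl]
      rintro (⟨h, rfl⟩ | ⟨h, rfl⟩)
      · exact .inl ⟨by rw [h, map_pt], map_valueAt _ _ _⟩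
      · refine .inr ⟨?_, by rw [map_valueAt, map_pt]⟩
        rcases h with h | h
        · exact .inl (by rw [h, map_pt])
        · exact .inr (by rw [h, map_pt]))
  let S := s.fillAt 1 true b (toUnit _) (toUnit_unique _ _)
  have hS : ∀ {c} (p : (pathObject A).obj c) (τ : (cube 2).obj c) (h : τ ∈ (openBox 1 true).obj c),
      S.app c (pair p τ) = b.app c (pair p ⟨τ, h⟩) :=
    fun p τ h => s.fillAt_box 1 true b (toUnit _) (toUnit_unique _ _) p ⟨τ, h⟩
  -- For a constant path the whole box is constant, hence degenerate in the open direction, and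
  -- normality makes its filler constant.
  have hS' : constPath A ▷ _ ≫ S = fst A (cube 2) := by
    have := s.fillAt_degenerate 1 true b (toUnit _) (toUnit_unique _ _) (constPath A) (fst A _)
      (tensor_hom_ext fun c x τ => by
        refine (hb c _ τ _ ?_).trans rfl
        rcases (mem_openBox_succ τ.1).1 τ.2 with h | ⟨_ | _, h⟩
        · exact .inr ⟨.inr (eq_pt ((mem_openBox_zero _).1 h)), (valueAt_constPath _ _).symm⟩
        · exact .inr ⟨.inl (eq_pt h), (valueAt_constPath _ _).symm⟩
        · exact .inl ⟨eq_pt h, (valueAt_constPath _ _).symm⟩)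
      (toUnit_unique _ _)
    rw [whiskerLeft_fst] at this
    exact this
  -- The path parameter becomes x₁ and the contraction parameter x₂, so the contraction ends at p on
  -- the face x₂ = 1.
  let r : cube 1 ⊗ (pathObject A ⊗ cube 1) ⟶ pathObject A ⊗ cube 2 :=
    { app := fun c => ↾fun z => pair z.2.1 (snoc z.2.2 z.1)
      naturality := fun c d φ => by
        refine ConcreteCategory.hom_ext _ _ fun z => ?_
        exact congrArg (pair _) (map_snoc φ z.2.2 z.1).symm }
  have hr : ∀ {c} (p : (pathObject A).obj c) (i j : (cube 1).obj c),
      valueAt ((MonoidalClosed.curry (r ≫ S)).app c (pair p i)) j =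
        S.app c (pair p (snoc i j)) := fun p i j => valueAt_curry _ _ _
  refine ⟨MonoidalClosed.curry (r ≫ S), path_hom_ext fun c p j => ?_,
    path_hom_ext fun c p j => ?_, path_hom_ext fun c z j => ?_⟩
  · refine (hr p (pt c false) j).trans ?_
    rw [hS p _ (snoc_pt_mem j false), NatTrans.comp_app_apply, valueAt_constPath]
    exact hb c p _ _ (.inr ⟨.inl (lastMap_snoc _ _), rfl⟩)
  · refine (hr p (pt c true) j).trans ?_
    rw [hS p _ (snoc_pt_mem j true)]
    exact hb c p _ _ (.inl ⟨lastMap_snoc _ _, by rw [initMap_snoc]; rfl⟩)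
  · obtain ⟨a, i, rfl⟩ := exists_pair z
    rw [NatTrans.comp_app_apply, whiskerRight_pair, hr, NatTrans.comp_app_apply, fst_pair,
      valueAt_constPath]
    exact congrArg (fun m => m.app c (pair a (snoc i j))) hS'

lemma constPath_evalAt (A : CubicalSet) (e : Bool) : constPath A ≫ evalAt A e = 𝟙 A := by
  ext c a
  exact valueAt_constPath a (pt c e)

lemma constPath_endpoints (A : CubicalSet) : constPath A ≫ endpoints A = diagonal A := by
  refine hom_ext_projAt fun e => ?_
  rw [Category.assoc, endpoints_projAt, constPath_evalAt]
  cases e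
  · exact (lift_fst _ _).symm
  · exact (lift_snd _ _).symm

/-- The constant path map of a normal Kan complex lifts against normal Kan fibrations. -/
lemma exists_lift_constPath (s : NormalKanFibration (toUnit A)) {Y : CubicalSet}
    {p : Y ⟶ pathObject A} (t : NormalKanFibration p) (y : A ⟶ Y) (hy : y ≫ p = constPath A) :
    ∃ d : pathObject A ⟶ Y, constPath A ≫ d = y ∧ d ≫ p = 𝟙 _ := by
  obtain ⟨h, h₀, h₁, hc⟩ := exists_contraction s
  -- The one-dimensional box that is open at 1 is just the point 0, where the contraction is the
  -- constant path at p(0), over which `y` supplies a point of Y.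
  have w : (fst (pathObject A) (box 0 true) ≫ evalAt A false ≫ y) ≫ p =
      pathObject A ◁ (openBox 0 true).ι ≫ h := by
    refine tensor_hom_ext fun c q z => ?_
    have hz : z.1 = pt c false := eq_pt ((mem_openBox_zero z.1).1 z.2)
    rw [Category.assoc, Category.assoc, hy]
    change (constPath A).app c ((evalAt A false).app c q) = h.app c (pair q z.1)
    rw [hz]
    exact (congrArg (fun m => m.app c q) h₀).symm
  -- Over constant paths both the contraction and the box are constant in the interval direction, so
  -- normality identifies the transport with `y`.
  have hT : constPath A ▷ _ ≫ t.fillAt 0 true _ h w =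
      A ◁ yoneda.map (Cube.proj 0) ≫ fst A (cube 0) ≫ y := by
    refine t.fillAt_degenerate 0 true _ h w (constPath A) (fst A (cube 0) ≫ y) ?_ ?_
    · rw [whiskerRight_fst_assoc, ← Category.assoc (constPath A), constPath_evalAt,
        Category.id_comp, whiskerLeft_fst_assoc, whiskerLeft_fst_assoc]
    · rw [hc, Category.assoc, hy, whiskerLeft_fst_assoc]
  refine ⟨lift (𝟙 _) (toUnit _ ≫ endpoint true) ≫ t.fillAt 0 true _ h w, ?_, ?_⟩
  · ext c a
    change (constPath A ▷ _ ≫ t.fillAt 0 true _ h w).app c (pair a (pt c true)) = _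
    rw [hT]
    rfl
  · rw [Category.assoc, t.fillAt_comp]
    exact h₁

end PathFibration

end CubicalSet

/-! ### The theorem for cubical sets -/

theorem mainTheorem1 :
    ∃ (W : AWFS CubicalSet)
      (e : ∀ {Y X : CubicalSet} (f : Y ⟶ X), W.RAlgebra f ≃ CubicalSet.NormalKanFibration f),
      (∀ {Y X Y' X' : CubicalSet} (f : Y ⟶ X) (f' : Y' ⟶ X')
        (s : W.RAlgebra f) (s' : W.RAlgebra f') (u : Y ⟶ Y') (v : X ⟶ X') (h : u ≫ f' = f ≫ v),
        s.IsHom s' (Arrow.homMk u v h) ↔ (e f s).IsHom (e f' s') u v h) ∧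
      ∀ A : CubicalSet, W.IsRMap (toUnit A) →
        W.IsLRFactorization (CubicalSet.constPath A) (CubicalSet.endpoints A)
          (CubicalSet.diagonal A) := by
  let F : ∀ ⦃A X : CubicalSet⦄ (f : A ⟶ X), CubicalSet.boxLifting.FreeFilling f :=
    fun _ _ f => LiftingData.freeFilling f
  let e {Y X : CubicalSet} (f : Y ⟶ X) :
      (LiftingData.freeAWFS F).RAlgebra f ≃ CubicalSet.NormalKanFibration f :=
    (LiftingData.algebraEquiv F f).trans (CubicalSet.fillingEquiv f)
  refine ⟨LiftingData.freeAWFS F, e, fun f f' s s' u v h => ?_, fun A ⟨s⟩ => ⟨?_, ?_, ?_⟩⟩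
  · exact (LiftingData.algebra_isHom_iff F s s' u v h).trans
      (CubicalSet.fillingEquiv_isHom_iff _ _ u v h)
  · exact CubicalSet.constPath_endpoints A
  · exact LiftingData.isLMap_of_lifts F _ fun p t y hy =>
      CubicalSet.exists_lift_constPath (e _ s) (CubicalSet.fillingEquiv p t) y hy
  · exact ⟨(e _).symm (CubicalSet.endpointsFibration (e _ s))⟩
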